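/- Let $p\neq 0$ be a real number and consider the gCH system for $u(t,x)$, $m(t,x)$, $$m=u-u_{xx},\qquad m_t=2p\,u^{p-1}u_x m+u^p m_x+\tfrac12 p(p-1)u^{p-2}(u^2-u_x^2)u_x .$$ An infinitesimal point symmetry of a system of differential equations on an open set $U$ of the space of independent and dependent variables is a smooth ($C^\infty$) vector field on $U$ (for the gCH system, $X=\tau\partial_t+\xi\partial_x+\eta\partial_u+\phi\partial_m$ with $\tau,\xi,\eta,\phi$ functions of $(t,x,u,m)$) whose prolongation to jet space, applied to each equation of the system, vanishes at every jet over $U$ that satisfies the system. Let $U$ be a non-empty connected open set of points $(t,x,u,m)\in\mathbb{R}^4$ at which the powers of $u$ in the system make sense ($u>0$ for arbitrary $p$; also $u<0$ if $p$ is an integer; all real $u$ if $p$ is a positive integer). Then the infinitesimal point symmetries of the gCH system on $U$ form a real Lie algebra of vector fields with basis (restricted to $U$) $$X_1=\partial_x,\qquad X_2=\partial_t,\qquad X_3=m\partial_m+u\partial_u-p\,t\,\partial_t ,$$ the $x$-translation, the $t$-translation and the scaling. In particular no extra symmetries occur for special values of $p\neq0$. Moreover every infinitesimal point symmetry of the system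 on $U$ projects under $(t,x,u,m)\mapsto(t,x,u)$ to an infinitesimal point symmetry, on the image of $U$, of the scalar gCH equation $$u_t-u_{txx}=\tfrac12(p+1)(p+2)u^pu_x-\tfrac12p(p-1)u^{p-2}u_x^3-2p\,u^{p-1}u_xu_{xx}-u^pu_{xxx}.$$ -/

import Mathlib

open scoped ContDiff

/-- The space of independent and dependent variables `(t, x, u¹, …, u^q)`. -/
abbrev TotalSpace (q : ℕ) : Type := ℝ × ℝ × (Fin q → ℝ)

/-- The jet space over two independent variables `(t, x)` and `q` dependent variables.
A jet is `(t, x, w)`, where `w α i j` is the coordinate `∂_t^i ∂_x^j u^α`.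
All orders are kept; a differential equation only reads finitely many coordinates. -/
abbrev JetSpace (q : ℕ) : Type := ℝ × ℝ × (Fin q → ℕ → ℕ → ℝ)

namespace JetSpace

variable {q : ℕ}

/-- The derivative coordinate `∂_t^i ∂_x^j u^α`. -/
def coord (J : JetSpace q) (α : Fin q) (i j : ℕ) : ℝ := J.2.2 α i j

/-- The point `(t, x, u)` below a jet. -/
def base (J : JetSpace q) : TotalSpace q := (J.1, J.2.1, fun α => J.coord α 0 0)

/-- The total derivative `D_t G = ∂G/∂t + ∑ u^α_{i+1,j} ∂G/∂u^α_{i,j}` of a function of jets,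
as the derivative of `G` in the direction `∂_t + ∑ u^α_{i+1,j} ∂/∂u^α_{i,j}`. -/
noncomputable def totalDerivT (G : JetSpace q → ℝ) : JetSpace q → ℝ := fun J =>
  lineDeriv ℝ G J (1, 0, fun α i j => J.coord α (i + 1) j)

/-- The total derivative `D_x G = ∂G/∂x + ∑ u^α_{i,j+1} ∂G/∂u^α_{i,j}`. -/
noncomputable def totalDerivX (G : JetSpace q → ℝ) : JetSpace q → ℝ := fun J =>
  lineDeriv ℝ G J (0, 1, fun α i j => J.coord α i (j + 1))

/-- The characteristic `Q^α = η^α - τ u^α_t - ξ u^α_x` of the vector field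
`X = τ ∂_t + ξ ∂_x + ∑ η^α ∂_{u^α}`. -/
def characteristic (X : TotalSpace q → TotalSpace q) (α : Fin q) : JetSpace q → ℝ := fun J =>
  (X J.base).2.2 α - (X J.base).1 * J.coord α 1 0 - (X J.base).2.1 * J.coord α 0 1

/-- The prolongation of `X` to jet space: the coefficient of `∂/∂u^α_{i,j}` is
`D_t^i D_x^j Q^α + τ u^α_{i+1,j} + ξ u^α_{i,j+1}`. -/
noncomputable def prolong (X : TotalSpace q → TotalSpace q) (J : JetSpace q) : JetSpace q :=
  ((X J.base).1, (X J.base).2.1, fun α i j =>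
    (totalDerivT^[i] (totalDerivX^[j] (characteristic X α))) J
      + (X J.base).1 * J.coord α (i + 1) j + (X J.base).2.1 * J.coord α i (j + 1))

end JetSpace

/-- `X` is an infinitesimal point symmetry, on the domain `U`, of the system of differential
equations `Δ k = 0`: it is a smooth vector field on `U`, and its prolongation applied to each
equation vanishes at every jet over `U` that satisfies the system. -/
def IsPointSymmetry {q : ℕ} {ι : Type*} (Δ : ι → JetSpace q → ℝ) (U : Set (TotalSpace q))
    (X : TotalSpace q → TotalSpace q) : Prop :=
  ContDiffOn ℝ ∞ X U ∧
    ∀ J : JetSpace q, J.base ∈ U → (∀ k, Δ k J = 0) →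
      ∀ k, lineDeriv ℝ (Δ k) J (JetSpace.prolong X J) = 0

/-- The values of `u` for which the real powers of `u` in the equations are meaningful: `u > 0`
for arbitrary `p`, also `u < 0` if `p` is an integer, and every `u` if `p` is a natural number. -/
def powDomain (p : ℝ) : Set ℝ :=
  {u | 0 < u ∨ (u ≠ 0 ∧ ∃ n : ℤ, p = n) ∨ ∃ n : ℕ, p = n}

/-- The gCH system for `u = u⁰`, `m = u¹`:
`m = u - u_xx`, `m_t = 2p u^{p-1} u_x m + u^p m_x + ½ p (p-1) u^{p-2} (u² - u_x²) u_x`. -/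
noncomputable def gchSystem (p : ℝ) : Fin 2 → JetSpace 2 → ℝ :=
  ![fun J =>
      let u := J.coord 0 0 0
      let uxx := J.coord 0 0 2
      let m := J.coord 1 0 0
      m - (u - uxx),
    fun J =>
      let u := J.coord 0 0 0
      let ux := J.coord 0 0 1
      let m := J.coord 1 0 0
      let mx := J.coord 1 0 1
      let mt := J.coord 1 1 0
      mt - (2 * p * u ^ (p - 1) * ux * m + u ^ p * mx
        + 1 / 2 * p * (p - 1) * u ^ (p - 2) * (u ^ 2 - ux ^ 2) * ux)]

/-- The scalar gCH equation
`u_t - u_txx = ½ (p+1)(p+2) u^p u_x - ½ p (p-1) u^{p-2} u_x³ - 2p u^{p-1} u_x u_xx - u^p u_xxx`. -/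
noncomputable def gchScalar (p : ℝ) : Fin 1 → JetSpace 1 → ℝ :=
  ![fun J =>
      let u := J.coord 0 0 0
      let ux := J.coord 0 0 1
      let uxx := J.coord 0 0 2
      let uxxx := J.coord 0 0 3
      let ut := J.coord 0 1 0
      let utxx := J.coord 0 1 2
      (ut - utxx) - (1 / 2 * (p + 1) * (p + 2) * u ^ p * ux
        - 1 / 2 * p * (p - 1) * u ^ (p - 2) * ux ^ 3
        - 2 * p * u ^ (p - 1) * ux * uxx - u ^ p * uxxx)]

/-- The generators `∂_x`, `∂_t` and `m ∂_m + u ∂_u - p t ∂_t` on the space of `(t, x, (u, m))`. -/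
def gchGenerator (p : ℝ) : Fin 3 → TotalSpace 2 → TotalSpace 2 :=
  ![fun _ => (0, 1, ![0, 0]),
    fun _ => (1, 0, ![0, 0]),
    fun z => (-p * z.1, 0, ![z.2.2 0, z.2.2 1])]

/-- The projection `(t, x, u, m) ↦ (t, x, u)`. As it is linear, it is also its own
differential on vectors. -/
def forgetM (z : TotalSpace 2) : TotalSpace 1 := (z.1, z.2.1, ![z.2.2 0])

/-! Write the field as τ∂_t + ξ∂_x + η∂_u + φ∂_m. The symmetry condition is tested at jets that
satisfy the two equations alone, without their differential consequences. Over a fixed point, u_xx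
and m_t are then determined, while u_t, u_x, u_tx, m_x, m_xx are free. The condition is polynomial
in the free coordinates, so its coefficients vanish separately.

The equation m = u - u_xx makes τ depend on t alone (locally), ξ on (t, x), makes η affine in u and
free of m, and expresses φ through η and ξ (`momentum_linear`, `momentum_consequences`). Where u ≠
0, the evolution equation adds φ_u = 0, (p-1)η_x = 0, a formula for φ_t and two further relations
(`evolution_linear`). Differentiating these relations and comparing them forces ξ_x = η_x = 0, τ_tt
= 0, ξ_t = 0, pη = -τ_t u and pφ = -τ_t m. The relations that carry a factor p - 1 say nothing when
p = 1; other coefficients supply the same conclusions there.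

The points with u ≠ 0 are dense, so the identities extend to U by continuity, and connectedness
integrates them to a∂_x + b∂_t plus a multiple of the scaling (`exists_eq_scalingField`).

Conversely, both right-hand sides are homogeneous of degree p + 1 in the x-jet of (u, m), which is
the weight that the scaling gives to t-derivatives. Brackets and projections are then read off from
the explicit fields. -/

/-! ### Directional derivatives on jet space, which carries no norm -/

section LineDerivative

variable {E : Type*} [AddCommGroup E] [Module ℝ E]

theorem HasLineDerivAt.add' {f g : E → ℝ} {f' g' : ℝ} {x v : E}
    (hf : HasLineDerivAt ℝ f f' x v) (hg : HasLineDerivAt ℝ g g' x v) :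
    HasLineDerivAt ℝ (fun y => f y + g y) (f' + g') x v :=
  HasDerivAt.add hf hg

theorem HasLineDerivAt.sub' {f g : E → ℝ} {f' g' : ℝ} {x v : E}
    (hf : HasLineDerivAt ℝ f f' x v) (hg : HasLineDerivAt ℝ g g' x v) :
    HasLineDerivAt ℝ (fun y => f y - g y) (f' - g') x v :=
  HasDerivAt.sub hf hg

theorem HasLineDerivAt.mul' {f g : E → ℝ} {f' g' : ℝ} {x v : E}
    (hf : HasLineDerivAt ℝ f f' x v) (hg : HasLineDerivAt ℝ g g' x v) :
    HasLineDerivAt ℝ (fun y => f y * g y) (f' * g x + f x * g') x v := by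
  have h := HasDerivAt.mul hf hg
  simp only [zero_smul, add_zero] at h
  exact h

theorem HasLineDerivAt.const' (c : ℝ) (x v : E) : HasLineDerivAt ℝ (fun _ : E => c) 0 x v :=
  hasDerivAt_const (0 : ℝ) c

theorem HasLineDerivAt.scomp {f : E → ℝ} {f' : ℝ} {x v : E} {g : ℝ → ℝ} {g' : ℝ}
    (hg : HasDerivAt g g' (f x)) (hf : HasLineDerivAt ℝ f f' x v) :
    HasLineDerivAt ℝ (fun y => g (f y)) (g' * f') x v := by
  have hg' : HasDerivAt g g' (f (x + (0 : ℝ) • v)) := by simpa using hg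
  exact HasDerivAt.comp (0 : ℝ) hg' hf

end LineDerivative

/-! ### Total derivatives and the prolongation formula up to second order -/

namespace JetSpace

variable {q : ℕ}

/-- The direction of the total derivative `D_t` at a jet. -/
def dirT (J : JetSpace q) : JetSpace q := (1, 0, fun α i j => J.coord α (i + 1) j)

/-- The direction of the total derivative `D_x` at a jet. -/
def dirX (J : JetSpace q) : JetSpace q := (0, 1, fun α i j => J.coord α i (j + 1))

theorem totalDerivT_apply (G : JetSpace q → ℝ) (J : JetSpace q) :
    totalDerivT G J = lineDeriv ℝ G J J.dirT := rfl

theorem totalDerivX_apply (G : JetSpace q → ℝ) (J : JetSpace q) :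
    totalDerivX G J = lineDeriv ℝ G J J.dirX := rfl

@[simp] theorem coord_dirT (J : JetSpace q) (α : Fin q) (i j : ℕ) :
    J.dirT.coord α i j = J.coord α (i + 1) j := rfl

@[simp] theorem coord_dirX (J : JetSpace q) (α : Fin q) (i j : ℕ) :
    J.dirX.coord α i j = J.coord α i (j + 1) := rfl

theorem fst_dirT (J : JetSpace q) : J.dirT.1 = 1 := rfl

theorem fst_dirX (J : JetSpace q) : J.dirX.1 = 0 := rfl

theorem hasLineDerivAt_coord (α : Fin q) (i j : ℕ) (J v : JetSpace q) :
    HasLineDerivAt ℝ (fun K : JetSpace q => K.coord α i j) (v.coord α i j) J v := by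
  have : HasDerivAt (fun s : ℝ => J.coord α i j + s * v.coord α i j) (1 * v.coord α i j) 0 :=
    ((hasDerivAt_id (0 : ℝ)).mul_const _).const_add _
  rw [one_mul] at this
  exact this

theorem hasLineDerivAt_time (J v : JetSpace q) :
    HasLineDerivAt ℝ (fun K : JetSpace q => K.1) v.1 J v := by
  have : HasDerivAt (fun s : ℝ => J.1 + s * v.1) (1 * v.1) 0 :=
    ((hasDerivAt_id (0 : ℝ)).mul_const _).const_add _
  rw [one_mul] at this
  exact this

theorem hasLineDerivAt_comp_base {f : TotalSpace q → ℝ} {J : JetSpace q}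
    (hf : DifferentiableAt ℝ f J.base) (v : JetSpace q) :
    HasLineDerivAt ℝ (fun K : JetSpace q => f K.base) (fderiv ℝ f J.base v.base) J v :=
  hf.hasFDerivAt.hasLineDerivAt v.base

theorem eventually_base_mem {U : Set (TotalSpace q)} (hU : IsOpen U) {J : JetSpace q}
    (hJ : J.base ∈ U) (v : JetSpace q) : ∀ᶠ s : ℝ in nhds 0, (J + s • v).base ∈ U := by
  have hc : Continuous fun s : ℝ => J.base + s • v.base := by fun_prop
  have h0 : J.base + (0 : ℝ) • v.base ∈ U := by simpa using hJ
  exact hc.continuousAt.eventually (hU.mem_nhds h0)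

/-- A short segment through a jet over the open set U stays over U, so values over the complement of
U are invisible to derivatives in any direction. -/
theorem lineDeriv_congr_over {U : Set (TotalSpace q)} (hU : IsOpen U) {G G' : JetSpace q → ℝ}
    (h : ∀ J : JetSpace q, J.base ∈ U → G J = G' J) {J : JetSpace q} (hJ : J.base ∈ U)
    (v : JetSpace q) : lineDeriv ℝ G J v = lineDeriv ℝ G' J v := by
  apply Filter.EventuallyEq.deriv_eq
  filter_upwards [eventually_base_mem hU hJ v] with s hs using h _ hs

theorem iterate_totalDeriv_congr_over {U : Set (TotalSpace q)} (hU : IsOpen U)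
    {G G' : JetSpace q → ℝ} (h : ∀ J : JetSpace q, J.base ∈ U → G J = G' J) (i j : ℕ) :
    ∀ J : JetSpace q, J.base ∈ U →
      (totalDerivT^[i] (totalDerivX^[j] G)) J = (totalDerivT^[i] (totalDerivX^[j] G')) J := by
  induction i with
  | zero =>
    induction j with
    | zero => simpa using h
    | succ j ih =>
      intro J hJ
      simp only [Function.iterate_zero, id, Function.iterate_succ_apply'] at ih ⊢
      exact lineDeriv_congr_over hU ih hJ _
  | succ i ih =>
    intro J hJ
    simp only [Function.iterate_succ_apply' totalDerivT]
    exact lineDeriv_congr_over hU ih hJ _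

/-- A symmetry is arbitrary outside U; this allows it to be replaced by an explicit global field
before prolonging. -/
theorem prolong_congr_over {U : Set (TotalSpace q)} (hU : IsOpen U)
    {X Y : TotalSpace q → TotalSpace q} (h : ∀ z ∈ U, X z = Y z) {J : JetSpace q}
    (hJ : J.base ∈ U) : prolong X J = prolong Y J := by
  have hc (α : Fin q) (K : JetSpace q) (hK : K.base ∈ U) :
      characteristic X α K = characteristic Y α K := by
    simp only [characteristic, h _ hK]
  simp only [prolong, h _ hJ, fun α i j => iterate_totalDeriv_congr_over hU (hc α) i j J hJ]

section Smooth

/-- The coefficient of `∂_t` of a vector field. -/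
def tComp (X : TotalSpace q → TotalSpace q) (z : TotalSpace q) : ℝ := (X z).1

/-- The coefficient of `∂_x` of a vector field. -/
def xComp (X : TotalSpace q → TotalSpace q) (z : TotalSpace q) : ℝ := (X z).2.1

/-- The coefficient of `∂/∂u^α` of a vector field. -/
def uComp (X : TotalSpace q → TotalSpace q) (α : Fin q) (z : TotalSpace q) : ℝ := (X z).2.2 α

variable {U : Set (TotalSpace q)} {X : TotalSpace q → TotalSpace q}

theorem contDiffOn_tComp (hX : ContDiffOn ℝ ∞ X U) : ContDiffOn ℝ ∞ (tComp X) U := hX.fst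

theorem contDiffOn_xComp (hX : ContDiffOn ℝ ∞ X U) : ContDiffOn ℝ ∞ (xComp X) U := hX.snd.fst

theorem contDiffOn_uComp (hX : ContDiffOn ℝ ∞ X U) (α : Fin q) :
    ContDiffOn ℝ ∞ (uComp X α) U := contDiffOn_pi.1 hX.snd.snd α

theorem _root_.ContDiffOn.differentiableAt_of_isOpen {E F : Type*} [NormedAddCommGroup E]
    [NormedSpace ℝ E] [NormedAddCommGroup F] [NormedSpace ℝ F] {V : Set E} {f : E → F}
    (hf : ContDiffOn ℝ ∞ f V) (hV : IsOpen V) {z : E} (hz : z ∈ V) : DifferentiableAt ℝ f z :=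
  (hf.contDiffAt (hV.mem_nhds hz)).differentiableAt (by simp)

theorem prolong_coord_zero_zero (α : Fin q) (J : JetSpace q) :
    (prolong X J).coord α 0 0 = uComp X α J.base := by
  simp only [prolong, coord, characteristic, uComp, Function.iterate_zero, id, Nat.zero_add]
  ring

theorem hasLineDerivAt_characteristic (hU : IsOpen U) (hX : ContDiffOn ℝ ∞ X U) (α : Fin q)
    {J : JetSpace q} (hJ : J.base ∈ U) (v : JetSpace q) :
    HasLineDerivAt ℝ (characteristic X α)
      (fderiv ℝ (uComp X α) J.base v.base
        - (fderiv ℝ (tComp X) J.base v.base * J.coord α 1 0 + tComp X J.base * v.coord α 1 0)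
        - (fderiv ℝ (xComp X) J.base v.base * J.coord α 0 1 + xComp X J.base * v.coord α 0 1))
      J v :=
  ((hasLineDerivAt_comp_base ((contDiffOn_uComp hX α).differentiableAt_of_isOpen hU hJ) v).sub'
    ((hasLineDerivAt_comp_base ((contDiffOn_tComp hX).differentiableAt_of_isOpen hU hJ) v).mul'
      (hasLineDerivAt_coord α 1 0 J v))).sub'
    ((hasLineDerivAt_comp_base ((contDiffOn_xComp hX).differentiableAt_of_isOpen hU hJ) v).mul'
      (hasLineDerivAt_coord α 0 1 J v))

theorem totalDerivX_characteristic (hU : IsOpen U) (hX : ContDiffOn ℝ ∞ X U) (α : Fin q)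
    {J : JetSpace q} (hJ : J.base ∈ U) :
    totalDerivX (characteristic X α) J =
      fderiv ℝ (uComp X α) J.base J.dirX.base
        - (fderiv ℝ (tComp X) J.base J.dirX.base * J.coord α 1 0 + tComp X J.base * J.coord α 1 1)
        - (fderiv ℝ (xComp X) J.base J.dirX.base * J.coord α 0 1
          + xComp X J.base * J.coord α 0 2) :=
  (hasLineDerivAt_characteristic hU hX α hJ J.dirX).lineDeriv

/-- The second derivatives u_tx and u_xx produced by D_x of the characteristic cancel against the
transport terms τ u_tx + ξ u_xx of the prolongation. -/
theorem prolong_coord_zero_one (hU : IsOpen U) (hX : ContDiffOn ℝ ∞ X U) (α : Fin q)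
    {J : JetSpace q} (hJ : J.base ∈ U) :
    (prolong X J).coord α 0 1 =
      fderiv ℝ (uComp X α) J.base J.dirX.base
        - fderiv ℝ (tComp X) J.base J.dirX.base * J.coord α 1 0
        - fderiv ℝ (xComp X) J.base J.dirX.base * J.coord α 0 1 := by
  have h : (prolong X J).coord α 0 1 = totalDerivX (characteristic X α) J
      + tComp X J.base * J.coord α 1 1 + xComp X J.base * J.coord α 0 2 := rfl
  rw [h, totalDerivX_characteristic hU hX α hJ]
  ring

theorem prolong_coord_one_zero (hU : IsOpen U) (hX : ContDiffOn ℝ ∞ X U) (α : Fin q)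
    {J : JetSpace q} (hJ : J.base ∈ U) :
    (prolong X J).coord α 1 0 =
      fderiv ℝ (uComp X α) J.base J.dirT.base
        - fderiv ℝ (tComp X) J.base J.dirT.base * J.coord α 1 0
        - fderiv ℝ (xComp X) J.base J.dirT.base * J.coord α 0 1 := by
  have h : (prolong X J).coord α 1 0 = totalDerivT (characteristic X α) J
      + tComp X J.base * J.coord α 2 0 + xComp X J.base * J.coord α 1 1 := rfl
  rw [h, totalDerivT_apply, (hasLineDerivAt_characteristic hU hX α hJ J.dirT).lineDeriv]
  simp only [coord_dirT, Nat.zero_add, Nat.reduceAdd]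
  ring

/-- The second total derivative `D_x² f` of a function `f` on the total space. -/
noncomputable def secondTotalX (f : TotalSpace q → ℝ) (J : JetSpace q) : ℝ :=
  fderiv ℝ (fderiv ℝ f) J.base J.dirX.base J.dirX.base
    + fderiv ℝ f J.base (0, 0, fun α => J.coord α 0 2)

theorem hasLineDerivAt_totalX (hU : IsOpen U) {f : TotalSpace q → ℝ} (hf : ContDiffOn ℝ ∞ f U)
    {J : JetSpace q} (hJ : J.base ∈ U) :
    HasLineDerivAt ℝ (fun K : JetSpace q => fderiv ℝ f K.base K.dirX.base) (secondTotalX f J)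
      J J.dirX := by
  have hf' : ContDiffOn ℝ ∞ (fderiv ℝ f) U := hf.fderiv_of_isOpen hU (by simp)
  have h1 : HasDerivAt (fun s : ℝ => fderiv ℝ f (J.base + s • J.dirX.base))
      (fderiv ℝ (fderiv ℝ f) J.base J.dirX.base) 0 :=
    (hf'.differentiableAt_of_isOpen hU hJ).hasFDerivAt.hasLineDerivAt J.dirX.base
  -- Along the line through J in direction D_x, the argument `K.dirX.base` moves affinely, with
  -- slope given by the second x-derivatives. The product rule for applying a moving functional to
  -- it gives both terms of D_x².
  have h2 : HasDerivAt (fun s : ℝ => J.dirX.base + s • ((0, 0, fun α => J.coord α 0 2) :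
      TotalSpace q)) ((1 : ℝ) • ((0, 0, fun α => J.coord α 0 2) : TotalSpace q)) 0 :=
    ((hasDerivAt_id (0 : ℝ)).smul_const _).const_add _
  have h := h1.clm_apply h2
  simp only [zero_smul, add_zero, one_smul] at h
  refine HasDerivAt.congr_of_eventuallyEq h (Filter.Eventually.of_forall fun s => ?_)
  refine congrArg (fderiv ℝ f (J.base + s • J.dirX.base)) ?_
  refine Prod.ext ?_ (Prod.ext ?_ ?_)
  · simp [base, dirX]
  · simp [base, dirX]
  · rfl

theorem prolong_coord_zero_two (hU : IsOpen U) (hX : ContDiffOn ℝ ∞ X U) (α : Fin q)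
    {J : JetSpace q} (hJ : J.base ∈ U) :
    (prolong X J).coord α 0 2 =
      secondTotalX (uComp X α) J - secondTotalX (tComp X) J * J.coord α 1 0
        - secondTotalX (xComp X) J * J.coord α 0 1
        - 2 * fderiv ℝ (tComp X) J.base J.dirX.base * J.coord α 1 1
        - 2 * fderiv ℝ (xComp X) J.base J.dirX.base * J.coord α 0 2 := by
  have h : (prolong X J).coord α 0 2 = totalDerivX (totalDerivX (characteristic X α)) J
      + tComp X J.base * J.coord α 1 2 + xComp X J.base * J.coord α 0 3 := rfl
  have hT := contDiffOn_tComp hX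
  have hΞ := contDiffOn_xComp hX
  have hD := (((hasLineDerivAt_totalX hU (contDiffOn_uComp hX α) hJ).sub'
    (((hasLineDerivAt_totalX hU hT hJ).mul' (hasLineDerivAt_coord α 1 0 J J.dirX)).add'
      ((hasLineDerivAt_comp_base (hT.differentiableAt_of_isOpen hU hJ) J.dirX).mul'
        (hasLineDerivAt_coord α 1 1 J J.dirX)))).sub'
    (((hasLineDerivAt_totalX hU hΞ hJ).mul' (hasLineDerivAt_coord α 0 1 J J.dirX)).add'
      ((hasLineDerivAt_comp_base (hΞ.differentiableAt_of_isOpen hU hJ) J.dirX).mul'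
        (hasLineDerivAt_coord α 0 2 J J.dirX)))).lineDeriv
  rw [h, totalDerivX_apply, lineDeriv_congr_over hU
    (fun K hK => totalDerivX_characteristic hU hX α hK) hJ J.dirX, hD]
  simp only [coord_dirX, Nat.zero_add, Nat.reduceAdd]
  ring

end Smooth
end JetSpace

/-! ### Partial derivatives of smooth functions on an open set -/

section PartialDerivative

variable {E : Type*} [NormedAddCommGroup E] [NormedSpace ℝ E] {V : Set E} {f g : E → ℝ} {z : E}

/-- The derivative of `f` in the constant direction `v`. -/
noncomputable def pd (v : E) (f : E → ℝ) (z : E) : ℝ := fderiv ℝ f z v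

theorem ContDiffOn.pd (hf : ContDiffOn ℝ ∞ f V) (hV : IsOpen V) (v : E) :
    ContDiffOn ℝ ∞ (pd v f) V :=
  (hf.fderiv_of_isOpen (m := ∞) hV (by simp)).clm_apply contDiffOn_const

theorem pd_congr (hV : IsOpen V) (h : ∀ y ∈ V, f y = g y) (hz : z ∈ V) (v : E) :
    pd v f z = pd v g z := by
  have : f =ᶠ[nhds z] g := by filter_upwards [hV.mem_nhds hz] with y hy using h y hy
  rw [pd, pd, this.fderiv_eq]

theorem pd_eq_zero_of_forall (hV : IsOpen V) (h : ∀ y ∈ V, f y = 0) (hz : z ∈ V) (v : E) :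
    pd v f z = 0 := by
  rw [pd_congr hV (g := fun _ => 0) h hz]
  simp [pd]

theorem fderiv_fderiv_apply (hf : ContDiffOn ℝ ∞ f V) (hV : IsOpen V) (hz : z ∈ V) (v w : E) :
    fderiv ℝ (fderiv ℝ f) z v w = pd v (pd w f) z := by
  have h : DifferentiableAt ℝ (fderiv ℝ f) z :=
    (hf.fderiv_of_isOpen (m := ∞) hV (by simp)).differentiableAt_of_isOpen hV hz
  change _ = fderiv ℝ (fun y => fderiv ℝ f y w) z v
  rw [fderiv_clm_apply h (differentiableAt_const w)]
  simp

theorem pd_comm (hf : ContDiffOn ℝ ∞ f V) (hV : IsOpen V) (hz : z ∈ V) (v w : E) :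
    pd v (pd w f) z = pd w (pd v f) z := by
  rw [← fderiv_fderiv_apply hf hV hz, ← fderiv_fderiv_apply hf hV hz]
  exact (hf.contDiffAt (hV.mem_nhds hz)).isSymmSndFDerivAt
    (by simpa using (ENat.LEInfty.out : (2 : WithTop ℕ∞) ≤ ∞)) v w

theorem ContDiffOn.hasLineDerivAt (hf : ContDiffOn ℝ ∞ f V) (hV : IsOpen V) (hz : z ∈ V)
    (v : E) : HasLineDerivAt ℝ f (_root_.pd v f z) z v :=
  (hf.differentiableAt_of_isOpen hV hz).hasFDerivAt.hasLineDerivAt v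

/-- The device for differentiating an identity: d is the expression delivered by the product rules,
and it becomes a new identity. -/
theorem HasLineDerivAt.eq_zero_of_forall {d : ℝ} {v : E} (hd : HasLineDerivAt ℝ f d z v)
    (hV : IsOpen V) (hz : z ∈ V) (h : ∀ y ∈ V, f y = 0) : d = 0 := by
  have h0 : f =ᶠ[nhds z] fun _ => 0 := by filter_upwards [hV.mem_nhds hz] with y hy using h y hy
  exact (h0.hasLineDerivAt_iff.1 hd).unique (HasLineDerivAt.const' 0 z v)

end PartialDerivative

/-! ### Coordinates (t, x, u, m) and coordinate vector fields -/

namespace TotalSpace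

/-- The coordinate vector field `∂_t`. -/
def eT : TotalSpace 2 := (1, 0, 0)

/-- The coordinate vector field `∂_x`. -/
def eX : TotalSpace 2 := (0, 1, 0)

/-- The coordinate vector field `∂_u`. -/
def eU : TotalSpace 2 := (0, 0, ![1, 0])

/-- The coordinate vector field `∂_m`. -/
def eM : TotalSpace 2 := (0, 0, ![0, 1])

/-- The coordinate `u`. -/
def u (z : TotalSpace 2) : ℝ := z.2.2 0

/-- The coordinate `m`. -/
def m (z : TotalSpace 2) : ℝ := z.2.2 1

theorem contDiff_u : ContDiff ℝ ∞ u := by unfold u; fun_prop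

theorem contDiff_m : ContDiff ℝ ∞ m := by unfold m; fun_prop

theorem pd_u (z v : TotalSpace 2) : pd v u z = v.2.2 0 := by
  let L : TotalSpace 2 →L[ℝ] ℝ :=
    (ContinuousLinearMap.proj (R := ℝ) (φ := fun _ : Fin 2 => ℝ) 0).comp
      ((ContinuousLinearMap.snd ℝ ℝ (Fin 2 → ℝ)).comp
        (ContinuousLinearMap.snd ℝ ℝ (ℝ × (Fin 2 → ℝ))))
  have h : HasFDerivAt u L z := L.hasFDerivAt
  rw [pd, h.fderiv]
  rfl

theorem pd_m (z v : TotalSpace 2) : pd v m z = v.2.2 1 := by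
  let L : TotalSpace 2 →L[ℝ] ℝ :=
    (ContinuousLinearMap.proj (R := ℝ) (φ := fun _ : Fin 2 => ℝ) 1).comp
      ((ContinuousLinearMap.snd ℝ ℝ (Fin 2 → ℝ)).comp
        (ContinuousLinearMap.snd ℝ ℝ (ℝ × (Fin 2 → ℝ))))
  have h : HasFDerivAt m L z := L.hasFDerivAt
  rw [pd, h.fderiv]
  rfl

theorem eq_combination (w : TotalSpace 2) :
    w = w.1 • eT + w.2.1 • eX + w.2.2 0 • eU + w.2.2 1 • eM := by
  refine Prod.ext ?_ (Prod.ext ?_ (funext fun i => ?_))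
  · simp [eT, eX, eU, eM]
  · simp [eT, eX, eU, eM]
  · fin_cases i <;> simp [eT, eX, eU, eM]

theorem clm_apply {F : Type*} [NormedAddCommGroup F] [NormedSpace ℝ F]
    (L : TotalSpace 2 →L[ℝ] F) (w : TotalSpace 2) :
    L w = w.1 • L eT + w.2.1 • L eX + w.2.2 0 • L eU + w.2.2 1 • L eM := by
  conv_lhs => rw [eq_combination w]
  simp only [map_add, map_smul]

theorem fderiv_eq_zero_iff {f : TotalSpace 2 → ℝ} {z : TotalSpace 2} :
    fderiv ℝ f z = 0 ↔ pd eT f z = 0 ∧ pd eX f z = 0 ∧ pd eU f z = 0 ∧ pd eM f z = 0 := by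
  constructor
  · intro h
    simp [pd, h]
  · rintro ⟨h1, h2, h3, h4⟩
    refine ContinuousLinearMap.ext fun w => ?_
    simp only [pd] at h1 h2 h3 h4
    rw [clm_apply, h1, h2, h3, h4]
    simp

end TotalSpace

/-! ### Test jets and the linearised system -/

open TotalSpace JetSpace

/-- A jet over `z` with prescribed derivatives, with `u_xx = u - m`. -/
def testJet (z : TotalSpace 2) (ut ux utx mt mx mxx : ℝ) : JetSpace 2 :=
  (z.1, z.2.1, ![
    fun i j => match i, j with
      | 0, 0 => u z
      | 0, 1 => ux
      | 0, 2 => u z - m z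
      | 1, 0 => ut
      | 1, 1 => utx
      | _, _ => 0,
    fun i j => match i, j with
      | 0, 0 => m z
      | 0, 1 => mx
      | 0, 2 => mxx
      | 1, 0 => mt
      | _, _ => 0])

theorem base_testJet (z : TotalSpace 2) (ut ux utx mt mx mxx : ℝ) :
    (testJet z ut ux utx mt mx mxx).base = z := by
  refine Prod.ext rfl (Prod.ext rfl (funext fun i => ?_))
  fin_cases i <;> rfl

/-- The right hand side of the evolution equation for `m`. -/
noncomputable def gchFlow (p u ux m mx : ℝ) : ℝ :=
  2 * p * u ^ (p - 1) * ux * m + u ^ p * mx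
    + 1 / 2 * p * (p - 1) * u ^ (p - 2) * (u ^ 2 - ux ^ 2) * ux

theorem gchSystem_zero_apply (p : ℝ) (J : JetSpace 2) :
    gchSystem p 0 J = J.coord 1 0 0 - (J.coord 0 0 0 - J.coord 0 0 2) := rfl

theorem gchSystem_one_apply (p : ℝ) (J : JetSpace 2) :
    gchSystem p 1 J = J.coord 1 1 0
      - gchFlow p (J.coord 0 0 0) (J.coord 0 0 1) (J.coord 1 0 0) (J.coord 1 0 1) := rfl

/-- Fixing u_xx and m_t is enough to solve the system, so the remaining five parameters can be
varied independently. -/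
theorem gchSystem_testJet (p : ℝ) (z : TotalSpace 2) (ut ux utx mx mxx : ℝ) (k : Fin 2) :
    gchSystem p k (testJet z ut ux utx (gchFlow p (u z) ux (m z) mx) mx mxx) = 0 := by
  fin_cases k
  · change m z - (u z - (u z - m z)) = 0
    ring
  · exact sub_self _

theorem hasLineDerivAt_gchSystem_zero (p : ℝ) (J v : JetSpace 2) :
    HasLineDerivAt ℝ (gchSystem p 0) (v.coord 1 0 0 - (v.coord 0 0 0 - v.coord 0 0 2)) J v :=
  (hasLineDerivAt_coord 1 0 0 J v).sub'
    ((hasLineDerivAt_coord 0 0 0 J v).sub' (hasLineDerivAt_coord 0 0 2 J v))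

/-- Every power of u is written as u^p over an integer power, so that u^p factors out and what
remains is rational in u. -/
theorem hasLineDerivAt_gchSystem_one (p : ℝ) (J v : JetSpace 2) (hu : J.coord 0 0 0 ≠ 0) :
    HasLineDerivAt ℝ (gchSystem p 1)
      (v.coord 1 1 0 - J.coord 0 0 0 ^ p *
        (2 * p * ((p - 1) / J.coord 0 0 0 ^ 2 * v.coord 0 0 0 * J.coord 0 0 1 * J.coord 1 0 0
            + (v.coord 0 0 1 * J.coord 1 0 0 + J.coord 0 0 1 * v.coord 1 0 0) / J.coord 0 0 0)
          + p / J.coord 0 0 0 * v.coord 0 0 0 * J.coord 1 0 1 + v.coord 1 0 1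
          + 1 / 2 * p * (p - 1) *
            ((p * v.coord 0 0 0 / J.coord 0 0 0 + - (p - 2) * J.coord 0 0 1 ^ 2
              / J.coord 0 0 0 ^ 3 * v.coord 0 0 0) * J.coord 0 0 1
              + (1 - 3 * J.coord 0 0 1 ^ 2 / J.coord 0 0 0 ^ 2) * v.coord 0 0 1)))
      J v := by
  have hU := hasLineDerivAt_coord 0 0 0 J v
  have hUx := hasLineDerivAt_coord 0 0 1 J v
  have hM := hasLineDerivAt_coord 1 0 0 J v
  have hpow (r : ℝ) := HasLineDerivAt.scomp
    (f := fun K : JetSpace 2 => K.coord 0 0 0) (g := fun y => y ^ r)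
    (g' := r * J.coord 0 0 0 ^ (r - 1))
    (Real.hasDerivAt_rpow_const (p := r) (Or.inl hu)) hU
  have hsq (j : ℕ) := HasLineDerivAt.scomp
    (f := fun K : JetSpace 2 => K.coord 0 0 j) (g := fun y => y ^ 2) (hasDerivAt_pow 2 _)
    (hasLineDerivAt_coord 0 0 j J v)
  have hc (c : ℝ) := HasLineDerivAt.const' c J v
  have key := (hasLineDerivAt_coord 1 1 0 J v).sub'
    ((((((hc (2 * p)).mul' (hpow (p - 1))).mul' hUx).mul' hM).add'
      ((hpow p).mul' (hasLineDerivAt_coord 1 0 1 J v))).add'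
      ((((hc (1 / 2 * p * (p - 1))).mul' (hpow (p - 2))).mul' ((hsq 0).sub' (hsq 1))).mul' hUx))
  have e1 : J.coord 0 0 0 ^ (p - 1) = J.coord 0 0 0 ^ p / J.coord 0 0 0 :=
    Real.rpow_sub_one hu p
  have e2 : J.coord 0 0 0 ^ (p - 2) = J.coord 0 0 0 ^ p / J.coord 0 0 0 ^ 2 := by
    simpa using Real.rpow_sub_natCast hu p 2
  have e3 : J.coord 0 0 0 ^ (p - 2 - 1) = J.coord 0 0 0 ^ p / J.coord 0 0 0 ^ 3 := by
    rw [Real.rpow_sub_one hu, e2]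
    field_simp
  have e2' : J.coord 0 0 0 ^ (p - 1 - 1) = J.coord 0 0 0 ^ p / J.coord 0 0 0 ^ 2 := by
    rw [← e2]
    ring_nf
  rw [e1, e2, e2', e3] at key
  refine (congrArg (fun d => HasLineDerivAt ℝ (gchSystem p 1) d J v) ?_).mp key
  field_simp
  ring

/-! ### Determining equations at the test jets -/

section Determining

variable {p : ℝ} {U : Set (TotalSpace 2)} {X : TotalSpace 2 → TotalSpace 2}

theorem secondTotalX_testJet (hU : IsOpen U) {f : TotalSpace 2 → ℝ}
    (hf : ContDiffOn ℝ ∞ f U) {z : TotalSpace 2} (hz : z ∈ U) (ut ux utx mt mx mxx : ℝ) :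
    secondTotalX f (testJet z ut ux utx mt mx mxx) =
      pd eX (pd eX f) z + ux ^ 2 * pd eU (pd eU f) z + mx ^ 2 * pd eM (pd eM f) z
        + 2 * ux * pd eX (pd eU f) z + 2 * mx * pd eX (pd eM f) z
        + 2 * ux * mx * pd eU (pd eM f) z + (u z - m z) * pd eU f z + mxx * pd eM f z := by
  have hw : (testJet z ut ux utx mt mx mxx).dirX.base = (0, 1, ![ux, mx]) := by
    refine Prod.ext rfl (Prod.ext rfl (funext fun i => ?_))
    fin_cases i <;> rfl
  have hw2 : ((0, 0, fun α => (testJet z ut ux utx mt mx mxx).coord α 0 2) : TotalSpace 2)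
      = (0, 0, ![u z - m z, mxx]) := by
    refine Prod.ext rfl (Prod.ext rfl (funext fun i => ?_))
    fin_cases i <;> rfl
  rw [secondTotalX, base_testJet, hw, hw2, clm_apply (fderiv ℝ (fderiv ℝ f) z),
    clm_apply (fderiv ℝ f z)]
  simp only [_root_.add_apply, _root_.smul_apply]
  rw [clm_apply (fderiv ℝ (fderiv ℝ f) z eT), clm_apply (fderiv ℝ (fderiv ℝ f) z eX),
    clm_apply (fderiv ℝ (fderiv ℝ f) z eU), clm_apply (fderiv ℝ (fderiv ℝ f) z eM)]
  simp only [fderiv_fderiv_apply hf hU hz, pd_comm hf hU hz eU eX, pd_comm hf hU hz eM eX,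
    pd_comm hf hU hz eM eU, smul_eq_mul, Matrix.cons_val_zero, Matrix.cons_val_one]
  simp only [pd]
  ring

theorem fderiv_dirX_testJet (f : TotalSpace 2 → ℝ) (z : TotalSpace 2)
    (ut ux utx mt mx mxx : ℝ) :
    fderiv ℝ f z (testJet z ut ux utx mt mx mxx).dirX.base =
      pd eX f z + ux * pd eU f z + mx * pd eM f z := by
  have hw : (testJet z ut ux utx mt mx mxx).dirX.base = (0, 1, ![ux, mx]) := by
    refine Prod.ext rfl (Prod.ext rfl (funext fun i => ?_))
    fin_cases i <;> rfl
  rw [hw, clm_apply]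
  simp [pd]

theorem fderiv_dirT_testJet (f : TotalSpace 2 → ℝ) (z : TotalSpace 2)
    (ut ux utx mt mx mxx : ℝ) :
    fderiv ℝ f z (testJet z ut ux utx mt mx mxx).dirT.base =
      pd eT f z + ut * pd eU f z + mt * pd eM f z := by
  have hw : (testJet z ut ux utx mt mx mxx).dirT.base = (1, 0, ![ut, mt]) := by
    refine Prod.ext rfl (Prod.ext rfl (funext fun i => ?_))
    fin_cases i <;> rfl
  rw [hw, clm_apply]
  simp [pd]

theorem determining_momentum (hU : IsOpen U) (h : IsPointSymmetry (gchSystem p) U X)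
    {z : TotalSpace 2} (hz : z ∈ U) (ut ux utx mx mxx : ℝ) :
    uComp X 1 z - uComp X 0 z
      + (pd eX (pd eX (uComp X 0)) z + ux ^ 2 * pd eU (pd eU (uComp X 0)) z
        + mx ^ 2 * pd eM (pd eM (uComp X 0)) z
        + 2 * ux * pd eX (pd eU (uComp X 0)) z + 2 * mx * pd eX (pd eM (uComp X 0)) z
        + 2 * ux * mx * pd eU (pd eM (uComp X 0)) z
        + (u z - m z) * pd eU (uComp X 0) z + mxx * pd eM (uComp X 0) z)
      - (pd eX (pd eX (tComp X)) z + ux ^ 2 * pd eU (pd eU (tComp X)) z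
        + mx ^ 2 * pd eM (pd eM (tComp X)) z
        + 2 * ux * pd eX (pd eU (tComp X)) z + 2 * mx * pd eX (pd eM (tComp X)) z
        + 2 * ux * mx * pd eU (pd eM (tComp X)) z
        + (u z - m z) * pd eU (tComp X) z + mxx * pd eM (tComp X) z) * ut
      - (pd eX (pd eX (xComp X)) z + ux ^ 2 * pd eU (pd eU (xComp X)) z
        + mx ^ 2 * pd eM (pd eM (xComp X)) z
        + 2 * ux * pd eX (pd eU (xComp X)) z + 2 * mx * pd eX (pd eM (xComp X)) z
        + 2 * ux * mx * pd eU (pd eM (xComp X)) z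
        + (u z - m z) * pd eU (xComp X) z + mxx * pd eM (xComp X) z) * ux
      - 2 * (pd eX (tComp X) z + ux * pd eU (tComp X) z + mx * pd eM (tComp X) z) * utx
      - 2 * (pd eX (xComp X) z + ux * pd eU (xComp X) z + mx * pd eM (xComp X) z) * (u z - m z)
      = 0 := by
  obtain ⟨hX, hs⟩ := h
  set J := testJet z ut ux utx (gchFlow p (u z) ux (m z) mx) mx mxx with hJdef
  have hb : J.base = z := base_testJet ..
  have hJ : J.base ∈ U := by rw [hb]; exact hz
  have key := hs J hJ (gchSystem_testJet p z ut ux utx mx mxx) 0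
  rw [(hasLineDerivAt_gchSystem_zero p J _).lineDeriv, prolong_coord_zero_zero,
    prolong_coord_zero_zero, prolong_coord_zero_two hU hX 0 hJ, hb, hJdef,
    fderiv_dirX_testJet, fderiv_dirX_testJet,
    secondTotalX_testJet hU (contDiffOn_uComp hX 0) hz,
    secondTotalX_testJet hU (contDiffOn_tComp hX) hz,
    secondTotalX_testJet hU (contDiffOn_xComp hX) hz] at key
  simp only [show (testJet z ut ux utx (gchFlow p (u z) ux (m z) mx) mx mxx).coord 0 1 0 = ut
      from rfl,
    show (testJet z ut ux utx (gchFlow p (u z) ux (m z) mx) mx mxx).coord 0 0 1 = ux from rfl,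
    show (testJet z ut ux utx (gchFlow p (u z) ux (m z) mx) mx mxx).coord 0 1 1 = utx from rfl,
    show (testJet z ut ux utx (gchFlow p (u z) ux (m z) mx) mx mxx).coord 0 0 2 = u z - m z
      from rfl] at key
  linear_combination key

theorem determining_evolution (hU : IsOpen U) (h : IsPointSymmetry (gchSystem p) U X)
    {z : TotalSpace 2} (hz : z ∈ U) (hu : u z ≠ 0) (ut ux mx : ℝ) {mt : ℝ}
    (hmt : mt = gchFlow p (u z) ux (m z) mx) :
    (pd eT (uComp X 1) z + ut * pd eU (uComp X 1) z + mt * pd eM (uComp X 1) z)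
      - (pd eT (tComp X) z + ut * pd eU (tComp X) z + mt * pd eM (tComp X) z) * mt
      - (pd eT (xComp X) z + ut * pd eU (xComp X) z + mt * pd eM (xComp X) z) * mx
      = u z ^ p *
        (2 * p * ((p - 1) / u z ^ 2 * uComp X 0 z * ux * m z
            + (((pd eX (uComp X 0) z + ux * pd eU (uComp X 0) z + mx * pd eM (uComp X 0) z)
              - (pd eX (tComp X) z + ux * pd eU (tComp X) z + mx * pd eM (tComp X) z) * ut
              - (pd eX (xComp X) z + ux * pd eU (xComp X) z + mx * pd eM (xComp X) z) * ux) * m z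
              + ux * uComp X 1 z) / u z)
          + p / u z * uComp X 0 z * mx
          + ((pd eX (uComp X 1) z + ux * pd eU (uComp X 1) z + mx * pd eM (uComp X 1) z)
              - (pd eX (tComp X) z + ux * pd eU (tComp X) z + mx * pd eM (tComp X) z) * mt
              - (pd eX (xComp X) z + ux * pd eU (xComp X) z + mx * pd eM (xComp X) z) * mx)
          + 1 / 2 * p * (p - 1) *
            ((p * uComp X 0 z / u z + - (p - 2) * ux ^ 2 / u z ^ 3 * uComp X 0 z) * ux
              + (1 - 3 * ux ^ 2 / u z ^ 2)
              * ((pd eX (uComp X 0) z + ux * pd eU (uComp X 0) z + mx * pd eM (uComp X 0) z)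
              - (pd eX (tComp X) z + ux * pd eU (tComp X) z + mx * pd eM (tComp X) z) * ut
              - (pd eX (xComp X) z + ux * pd eU (xComp X) z + mx * pd eM (xComp X) z) * ux))) := by
  obtain ⟨hX, hs⟩ := h
  set J := testJet z ut ux 0 mt mx 0 with hJdef
  have hb : J.base = z := base_testJet ..
  have hJ : J.base ∈ U := by rw [hb]; exact hz
  have key := hs J hJ (fun k => by rw [hJdef, hmt]; exact gchSystem_testJet p z ut ux 0 mx 0 k) 1
  rw [(hasLineDerivAt_gchSystem_one p J _ hu).lineDeriv, prolong_coord_zero_zero,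
    prolong_coord_zero_zero, prolong_coord_zero_one hU hX 0 hJ, prolong_coord_zero_one hU hX 1 hJ,
    prolong_coord_one_zero hU hX 1 hJ, hb, hJdef] at key
  simp only [fderiv_dirX_testJet, fderiv_dirT_testJet] at key
  simp only [show (testJet z ut ux 0 mt mx 0).coord 0 0 0 = u z from rfl,
    show (testJet z ut ux 0 mt mx 0).coord 0 1 0 = ut from rfl,
    show (testJet z ut ux 0 mt mx 0).coord 0 0 1 = ux from rfl,
    show (testJet z ut ux 0 mt mx 0).coord 1 0 0 = m z from rfl,
    show (testJet z ut ux 0 mt mx 0).coord 1 1 0 = mt from rfl,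
    show (testJet z ut ux 0 mt mx 0).coord 1 0 1 = mx from rfl] at key
  linear_combination key

end Determining

/-! ### Splitting the determining equations into coefficients -/

section Solving

variable {p : ℝ} {U : Set (TotalSpace 2)} {X : TotalSpace 2 → TotalSpace 2}

theorem rpow_ne_zero_of_mem_powDomain {y : ℝ} (hy : y ∈ powDomain p) (h0 : y ≠ 0) :
    y ^ p ≠ 0 := by
  rcases hy with h | ⟨-, n, rfl⟩ | ⟨n, rfl⟩
  · exact (Real.rpow_pos_of_pos h p).ne'
  · rw [Real.rpow_intCast]
    exact zpow_ne_zero n h0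
  · rw [Real.rpow_natCast]
    exact pow_ne_zero n h0

theorem gchFlow_eq (p : ℝ) {y : ℝ} (hy : y ≠ 0) (ux m mx : ℝ) :
    gchFlow p y ux m mx =
      y ^ p * (2 * p * ux * m / y + mx + 1 / 2 * p * (p - 1) * (1 - ux ^ 2 / y ^ 2) * ux) := by
  have e2 : y ^ (p - 2) = y ^ p / y ^ 2 := by simpa using Real.rpow_sub_natCast hy p 2
  rw [gchFlow, Real.rpow_sub_one hy, e2]
  field_simp

theorem momentum_linear (hU : IsOpen U) (h : IsPointSymmetry (gchSystem p) U X)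
    {z : TotalSpace 2} (hz : z ∈ U) :
    pd eX (tComp X) z = 0 ∧ pd eU (tComp X) z = 0 ∧ pd eM (tComp X) z = 0 ∧
      pd eM (uComp X 0) z = 0 ∧ pd eM (xComp X) z = 0 ∧
      2 * pd eX (pd eU (uComp X 0)) z - pd eX (pd eX (xComp X)) z
        - 3 * pd eU (xComp X) z * (u z - m z) = 0 ∧
      pd eU (pd eU (uComp X 0)) z = 2 * pd eX (pd eU (xComp X)) z ∧
      uComp X 1 z = uComp X 0 z - pd eX (pd eX (uComp X 0)) z
        - (pd eU (uComp X 0) z - 2 * pd eX (xComp X) z) * (u z - m z) := by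
  -- Coefficients are read off by finite differences, with arguments in the order u_t, u_x, u_tx,
  -- m_x, m_xx. With the other parameters zero the condition is a cubic in u_x, and its values at 0,
  -- 1, -1, 2 isolate the linear and quadratic coefficients.
  have D := determining_momentum hU h hz
  have d0 := D 0 0 0 0 0
  have d1 := D 0 0 1 0 0
  have d2 := D 0 1 1 0 0
  have d3 := D 0 1 0 0 0
  have d4 := D 0 0 1 1 0
  have d5 := D 0 0 0 1 0
  have d6 := D 0 0 0 0 1
  have d7 := D 0 1 0 0 1
  have d8 := D 0 (-1) 0 0 0
  have d9 := D 0 2 0 0 0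
  refine ⟨?_, ?_, ?_, ?_, ?_, ?_, ?_, ?_⟩ <;> clear D
  · linear_combination (d0 - d1) / 2
  · linear_combination (d3 - d2) / 2 - (d0 - d1) / 2
  · linear_combination (d5 - d4) / 2 - (d0 - d1) / 2
  · linear_combination d6 - d0
  · linear_combination d6 - d0 - (d7 - d3)
  · linear_combination (8 * ((d3 - d8) / 2) - (d9 - d0 - 4 * ((d3 + d8) / 2 - d0))) / 6
  · linear_combination (d3 + d8) / 2 - d0
  · linear_combination d0

theorem momentum_consequences (hU : IsOpen U) (h : IsPointSymmetry (gchSystem p) U X)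
    {z : TotalSpace 2} (hz : z ∈ U) :
    pd eU (xComp X) z = 0 ∧ pd eU (pd eU (uComp X 0)) z = 0 ∧
      2 * pd eX (pd eU (uComp X 0)) z = pd eX (pd eX (xComp X)) z := by
  have hΞ := contDiffOn_xComp h.1
  have hH := contDiffOn_uComp h.1 0
  have hu : ContDiffOn ℝ ∞ u U := contDiff_u.contDiffOn
  have hm : ContDiffOn ℝ ∞ m U := contDiff_m.contDiffOn
  have key : ∀ y ∈ U, pd eU (xComp X) y = 0 := by
    intro y hy
    -- In the u_x-coefficient 2η_xu - ξ_xx - 3ξ_u(u - m) only the explicit m depends on m, so its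
    -- m-derivative is 3ξ_u.
    have hd := ((((HasLineDerivAt.const' 2 y eM).mul'
      (((hH.pd hU eU).pd hU eX).hasLineDerivAt hU hy eM)).sub'
      (((hΞ.pd hU eX).pd hU eX).hasLineDerivAt hU hy eM)).sub'
      (((HasLineDerivAt.const' 3 y eM).mul' ((hΞ.pd hU eU).hasLineDerivAt hU hy eM)).mul'
        ((hu.hasLineDerivAt hU hy eM).sub' (hm.hasLineDerivAt hU hy eM)))).eq_zero_of_forall hU hy
      (fun w hw => (momentum_linear hU h hw).2.2.2.2.2.1)
    have hHm : ∀ w ∈ U, pd eM (uComp X 0) w = 0 := fun w hw =>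
      (momentum_linear hU h hw).2.2.2.1
    have hΞm : ∀ w ∈ U, pd eM (xComp X) w = 0 := fun w hw =>
      (momentum_linear hU h hw).2.2.2.2.1
    have e1 : pd eM (pd eX (pd eU (uComp X 0))) y = 0 := by
      rw [pd_comm (hH.pd hU eU) hU hy]
      refine pd_eq_zero_of_forall hU (fun w hw => ?_) hy eX
      rw [pd_comm hH hU hw]
      exact pd_eq_zero_of_forall hU hHm hw eU
    have e2 : pd eM (pd eX (pd eX (xComp X))) y = 0 := by
      rw [pd_comm (hΞ.pd hU eX) hU hy]
      refine pd_eq_zero_of_forall hU (fun w hw => ?_) hy eX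
      rw [pd_comm hΞ hU hw]
      exact pd_eq_zero_of_forall hU hΞm hw eX
    have e3 : pd eM (pd eU (xComp X)) y = 0 := by
      rw [pd_comm hΞ hU hy]
      exact pd_eq_zero_of_forall hU hΞm hy eU
    rw [e1, e2, e3, pd_u, pd_m] at hd
    simp only [eM, Matrix.cons_val_zero, Matrix.cons_val_one] at hd
    linear_combination hd / 3
  obtain ⟨-, -, -, -, -, h1, h2, -⟩ := momentum_linear hU h hz
  refine ⟨key z hz, ?_, ?_⟩
  · rw [h2, pd_eq_zero_of_forall hU key hz]
    ring
  · linear_combination h1 + 3 * (u z - m z) * key z hz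

theorem evolution_linear (hp : p ≠ 0) (hU : IsOpen U) (h : IsPointSymmetry (gchSystem p) U X)
    {z : TotalSpace 2} (hz : z ∈ U) (hu : u z ≠ 0) (hK : u z ^ p ≠ 0) :
    pd eU (uComp X 1) z = 0 ∧
      u z ^ p * (pd eX (xComp X) z * u z - pd eT (tComp X) z * u z - p * uComp X 0 z)
        = pd eT (xComp X) z * u z ∧
      pd eT (uComp X 1) z = u z ^ p * (2 * p * pd eX (uComp X 0) z * m z / u z
        + pd eX (uComp X 1) z + 1 / 2 * p * (p - 1) * pd eX (uComp X 0) z) ∧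
      (p - 1) * pd eX (uComp X 0) z = 0 ∧
      (pd eM (uComp X 1) z - pd eT (tComp X) z) * (2 * p * m z / u z + 1 / 2 * p * (p - 1)) =
        2 * p * ((p - 1) / u z ^ 2 * uComp X 0 z * m z
          + ((pd eU (uComp X 0) z - pd eX (xComp X) z) * m z + uComp X 1 z) / u z)
        + 1 / 2 * p * (p - 1) * (p * uComp X 0 z / u z + pd eU (uComp X 0) z
          - pd eX (xComp X) z) := by
  obtain ⟨hTx, hTu, hTm, hHm, hΞm, -, -, -⟩ := momentum_linear hU h hz
  obtain ⟨hΞu, -, -⟩ := momentum_consequences hU h hz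
  have D := fun ut ux mx => determining_evolution hU h hz hu ut ux mx rfl
  simp only [hTx, hTu, hTm, hHm, hΞm, hΞu, gchFlow_eq p hu] at D
  -- The evolution equation does not involve u_t, and τ_u = τ_x = τ_m = ξ_u = 0, so φ_u is the only
  -- coefficient of u_t left.
  have hPu : pd eU (uComp X 1) z = 0 := by
    linear_combination D 1 0 0 - D 0 0 0
  simp only [hPu] at D
  have d0 := D 0 0 0
  have d1 := D 0 1 0
  have d2 := D 0 (-1) 0
  have d3 := D 0 2 0
  have d4 := D 0 0 1
  clear D
  refine ⟨hPu, ?_, ?_, ?_, ?_⟩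
  · have hinv : u z * (u z)⁻¹ = 1 := mul_inv_cancel₀ hu
    linear_combination u z * (d4 - d0) + u z ^ p * p * uComp X 0 z * hinv
  · linear_combination d0
  -- The u_x²-coefficient: m_t is odd in u_x at m_x = 0, so only the factor 1 - 3u_x²/u² multiplying
  -- η_x contributes.
  · have : u z ^ p * (p * ((u z)⁻¹ ^ 2 * ((p - 1) * pd eX (uComp X 0) z))) = 0 := by
      linear_combination (d1 + d2 - 2 * d0) / 3
    simpa [hK, hp, hu] using this
  · apply mul_left_cancel₀ hK
    linear_combination (8 * ((d1 - d2) / 2) - (d3 - d0 - 4 * ((d1 + d2) / 2 - d0))) / 6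

end Solving

/-! ### Compatibility of the coefficient relations where u ≠ 0 -/

section Solving

variable {p : ℝ} {U : Set (TotalSpace 2)} {X : TotalSpace 2 → TotalSpace 2}

theorem isOpen_inter_u_ne_zero (hU : IsOpen U) : IsOpen {z | z ∈ U ∧ u z ≠ 0} :=
  hU.inter (isOpen_ne_fun contDiff_u.continuous continuous_const)

theorem hasLineDerivAt_u_rpow {z : TotalSpace 2} (hu : u z ≠ 0) (v : TotalSpace 2) :
    HasLineDerivAt ℝ (fun y => u y ^ p) (p * (u z ^ p / u z) * v.2.2 0) z v := by
  have h := HasLineDerivAt.scomp (g := fun y => y ^ p)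
    (Real.hasDerivAt_rpow_const (p := p) (Or.inl hu))
    (contDiff_u.contDiffOn.hasLineDerivAt isOpen_univ (Set.mem_univ z) v)
  rwa [pd_u, Real.rpow_sub_one hu] at h

/-- The `m_x`-coefficient of the evolution condition, differentiated along `v`. -/
theorem evolution_mx_derivative (hp : p ≠ 0) (hU : IsOpen U)
    (hUp : ∀ z ∈ U, z.2.2 0 ∈ powDomain p) (h : IsPointSymmetry (gchSystem p) U X)
    {z : TotalSpace 2} (hz : z ∈ U) (hu : u z ≠ 0) (v : TotalSpace 2) :
    p * (u z ^ p / u z) * v.2.2 0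
        * (pd eX (xComp X) z * u z - pd eT (tComp X) z * u z - p * uComp X 0 z)
      + u z ^ p * (pd v (pd eX (xComp X)) z * u z + pd eX (xComp X) z * v.2.2 0
        - (pd v (pd eT (tComp X)) z * u z + pd eT (tComp X) z * v.2.2 0)
        - p * pd v (uComp X 0) z)
      = pd v (pd eT (xComp X)) z * u z + pd eT (xComp X) z * v.2.2 0 := by
  have hT := contDiffOn_tComp h.1
  have hΞ := contDiffOn_xComp h.1
  have hH := contDiffOn_uComp h.1 0
  have hu' : HasLineDerivAt ℝ u (v.2.2 0) z v := by
    have := contDiff_u.contDiffOn.hasLineDerivAt isOpen_univ (Set.mem_univ z) v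
    rwa [pd_u] at this
  have hd := (((hasLineDerivAt_u_rpow (p := p) hu v).mul'
    (((((hΞ.pd hU eX).hasLineDerivAt hU hz v).mul' hu').sub'
      (((hT.pd hU eT).hasLineDerivAt hU hz v).mul' hu')).sub'
      ((HasLineDerivAt.const' p z v).mul' (hH.hasLineDerivAt hU hz v)))).sub'
    (((hΞ.pd hU eT).hasLineDerivAt hU hz v).mul' hu')).eq_zero_of_forall
    (isOpen_inter_u_ne_zero hU) ⟨hz, hu⟩ (fun y hy => sub_eq_zero.2
      (evolution_linear hp hU h hy.1 hy.2
        (rpow_ne_zero_of_mem_powDomain (hUp y hy.1) hy.2)).2.1)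
  linear_combination hd

theorem tComp_mixed_eq_zero (hU : IsOpen U) (h : IsPointSymmetry (gchSystem p) U X)
    {z : TotalSpace 2} (hz : z ∈ U) :
    pd eX (pd eT (tComp X)) z = 0 ∧ pd eU (pd eT (tComp X)) z = 0 ∧
      pd eM (pd eT (tComp X)) z = 0 := by
  have hT := contDiffOn_tComp h.1
  refine ⟨?_, ?_, ?_⟩
  · rw [pd_comm hT hU hz]
    exact pd_eq_zero_of_forall hU (fun y hy => (momentum_linear hU h hy).1) hz _
  · rw [pd_comm hT hU hz]
    exact pd_eq_zero_of_forall hU (fun y hy => (momentum_linear hU h hy).2.1) hz _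
  · rw [pd_comm hT hU hz]
    exact pd_eq_zero_of_forall hU (fun y hy => (momentum_linear hU h hy).2.2.1) hz _

theorem xComp_mixed_eq_zero (hU : IsOpen U) (h : IsPointSymmetry (gchSystem p) U X)
    {z : TotalSpace 2} (hz : z ∈ U) (v : TotalSpace 2) :
    pd eU (pd v (xComp X)) z = 0 ∧ pd eM (pd v (xComp X)) z = 0 := by
  have hΞ := contDiffOn_xComp h.1
  refine ⟨?_, ?_⟩
  · rw [pd_comm hΞ hU hz]
    exact pd_eq_zero_of_forall hU (fun y hy => (momentum_consequences hU h hy).1) hz _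
  · rw [pd_comm hΞ hU hz]
    exact pd_eq_zero_of_forall hU (fun y hy => (momentum_linear hU h hy).2.2.2.2.1) hz _

/-- Eliminate ξ_t between the m_x-relation u^p(ξ_x u - τ_t u - pη) = ξ_t u and u times its
u-derivative, then divide by p u^p. -/
theorem scaling_relation (hp : p ≠ 0) (hU : IsOpen U)
    (hUp : ∀ z ∈ U, z.2.2 0 ∈ powDomain p) (h : IsPointSymmetry (gchSystem p) U X)
    {z : TotalSpace 2} (hz : z ∈ U) (hu : u z ≠ 0) :
    (pd eX (xComp X) z - pd eT (tComp X) z) * u z - (p - 1) * uComp X 0 z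
      - u z * pd eU (uComp X 0) z = 0 := by
  have hK : u z ^ p ≠ 0 := rpow_ne_zero_of_mem_powDomain (hUp z hz) hu
  have h0 := (evolution_linear hp hU h hz hu hK).2.1
  have h1 := evolution_mx_derivative hp hU hUp h hz hu eU
  rw [(xComp_mixed_eq_zero hU h hz eX).1, (xComp_mixed_eq_zero hU h hz eT).1,
    (tComp_mixed_eq_zero hU h hz).2.1] at h1
  simp only [eU, Matrix.cons_val_zero] at h1
  have : u z ^ p * (p * ((pd eX (xComp X) z - pd eT (tComp X) z) * u z - (p - 1) * uComp X 0 z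
      - u z * pd eU (uComp X 0) z)) = 0 := by
    simp only [eU] at h0 ⊢
    field_simp at h1
    linear_combination h1 - h0
  simpa [hK, hp] using this

/-- The u-derivative of `scaling_relation`, in which η_uu = 0. -/
theorem pd_u_uComp (hp : p ≠ 0) (hU : IsOpen U)
    (hUp : ∀ z ∈ U, z.2.2 0 ∈ powDomain p) (h : IsPointSymmetry (gchSystem p) U X)
    {z : TotalSpace 2} (hz : z ∈ U) (hu : u z ≠ 0) :
    pd eX (xComp X) z - pd eT (tComp X) z - p * pd eU (uComp X 0) z = 0 := by
  have hT := contDiffOn_tComp h.1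
  have hΞ := contDiffOn_xComp h.1
  have hH := contDiffOn_uComp h.1 0
  have hu' : HasLineDerivAt ℝ u 1 z eU := by
    have := contDiff_u.contDiffOn.hasLineDerivAt isOpen_univ (Set.mem_univ z) eU
    rwa [pd_u] at this
  have hd := ((((((hΞ.pd hU eX).hasLineDerivAt hU hz eU).sub'
      ((hT.pd hU eT).hasLineDerivAt hU hz eU)).mul' hu').sub'
      ((HasLineDerivAt.const' (p - 1) z eU).mul' (hH.hasLineDerivAt hU hz eU))).sub'
    (hu'.mul' ((hH.pd hU eU).hasLineDerivAt hU hz eU))).eq_zero_of_forall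
    (isOpen_inter_u_ne_zero hU) ⟨hz, hu⟩
    (fun y hy => scaling_relation hp hU hUp h hy.1 hy.2)
  rw [(xComp_mixed_eq_zero hU h hz eX).1, (tComp_mixed_eq_zero hU h hz).2.1,
    (momentum_consequences hU h hz).2.1] at hd
  linear_combination hd

theorem xComp_xx_eq_zero (hp : p ≠ 0) (hU : IsOpen U)
    (hUp : ∀ z ∈ U, z.2.2 0 ∈ powDomain p) (h : IsPointSymmetry (gchSystem p) U X)
    {z : TotalSpace 2} (hz : z ∈ U) (hu : u z ≠ 0) :
    pd eX (pd eX (xComp X)) z = 0 := by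
  have hT := contDiffOn_tComp h.1
  have hΞ := contDiffOn_xComp h.1
  have hH := contDiffOn_uComp h.1 0
  have hV := isOpen_inter_u_ne_zero hU
  have hxx := (momentum_consequences hU h hz).2.2
  -- For p = 1 the relation (p-1)η_x = 0 is void, but the x-derivative of `pd_u_uComp` gives ξ_xx =
  -- η_xu, against 2η_xu = ξ_xx. For p ≠ 1, η_x = 0 already gives η_xu = 0.
  by_cases hp1 : p = 1
  · have hd := ((((hΞ.pd hU eX).hasLineDerivAt hU hz eX).sub'
      ((hT.pd hU eT).hasLineDerivAt hU hz eX)).sub'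
      ((HasLineDerivAt.const' p z eX).mul'
        ((hH.pd hU eU).hasLineDerivAt hU hz eX))).eq_zero_of_forall hV ⟨hz, hu⟩
      (fun y hy => pd_u_uComp hp hU hUp h hy.1 hy.2)
    rw [(tComp_mixed_eq_zero hU h hz).1, hp1] at hd
    linear_combination 2 * hd + hxx
  · have hHx : ∀ y ∈ {y | y ∈ U ∧ u y ≠ 0}, pd eX (uComp X 0) y = 0 := fun y hy =>
      (mul_eq_zero.1 (evolution_linear hp hU h hy.1 hy.2
        (rpow_ne_zero_of_mem_powDomain (hUp y hy.1) hy.2)).2.2.2.1).resolve_left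
        (sub_ne_zero.2 hp1)
    have := pd_eq_zero_of_forall hV hHx ⟨hz, hu⟩ eU
    rw [pd_comm hH hU hz] at this
    rw [← hxx, this, mul_zero]

theorem momentum_coefficient_derivative (hU : IsOpen U) (h : IsPointSymmetry (gchSystem p) U X)
    {z : TotalSpace 2} (hz : z ∈ U) (v : TotalSpace 2) :
    pd v (uComp X 1) z = pd v (uComp X 0) z - pd v (pd eX (pd eX (uComp X 0))) z
      - ((pd v (pd eU (uComp X 0)) z - 2 * pd v (pd eX (xComp X)) z) * (u z - m z)
        + (pd eU (uComp X 0) z - 2 * pd eX (xComp X) z) * (v.2.2 0 - v.2.2 1)) := by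
  have hΞ := contDiffOn_xComp h.1
  have hH := contDiffOn_uComp h.1 0
  have hP := contDiffOn_uComp h.1 1
  have hu' := contDiff_u.contDiffOn.hasLineDerivAt isOpen_univ (Set.mem_univ z) v
  have hm' := contDiff_m.contDiffOn.hasLineDerivAt isOpen_univ (Set.mem_univ z) v
  have hd := ((hP.hasLineDerivAt hU hz v).sub'
    (((hH.hasLineDerivAt hU hz v).sub'
      (((hH.pd hU eX).pd hU eX).hasLineDerivAt hU hz v)).sub'
      ((((hH.pd hU eU).hasLineDerivAt hU hz v).sub'
        ((HasLineDerivAt.const' 2 z v).mul' ((hΞ.pd hU eX).hasLineDerivAt hU hz v))).mul'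
        (hu'.sub' hm')))).eq_zero_of_forall hU hz
    (fun y hy => sub_eq_zero.2 (momentum_linear hU h hy).2.2.2.2.2.2.2)
  rw [pd_u, pd_m] at hd
  linear_combination hd

theorem uComp_xu_eq_zero (hp : p ≠ 0) (hU : IsOpen U)
    (hUp : ∀ z ∈ U, z.2.2 0 ∈ powDomain p) (h : IsPointSymmetry (gchSystem p) U X)
    {z : TotalSpace 2} (hz : z ∈ U) (hu : u z ≠ 0) :
    pd eX (pd eU (uComp X 0)) z = 0 := by
  have := (momentum_consequences hU h hz).2.2
  rw [xComp_xx_eq_zero hp hU hUp h hz hu] at this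
  linarith

/-- The u-derivative of φ = η - η_xx - (η_u - 2ξ_x)(u - m) collapses to 2ξ_x, while φ_u = 0. -/
theorem xComp_x_eq_zero (hp : p ≠ 0) (hU : IsOpen U)
    (hUp : ∀ z ∈ U, z.2.2 0 ∈ powDomain p) (h : IsPointSymmetry (gchSystem p) U X)
    {z : TotalSpace 2} (hz : z ∈ U) (hu : u z ≠ 0) :
    pd eX (xComp X) z = 0 := by
  have hH := contDiffOn_uComp h.1 0
  have hV := isOpen_inter_u_ne_zero hU
  have hd := momentum_coefficient_derivative hU h hz eU
  have e : pd eU (pd eX (pd eX (uComp X 0))) z = 0 := by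
    rw [pd_comm (hH.pd hU eX) hU hz]
    refine pd_eq_zero_of_forall hV (fun y hy => ?_) ⟨hz, hu⟩ eX
    rw [pd_comm hH hU hy.1]
    exact uComp_xu_eq_zero hp hU hUp h hy.1 hy.2
  rw [e, (xComp_mixed_eq_zero hU h hz eX).1, (momentum_consequences hU h hz).2.1,
    (evolution_linear hp hU h hz hu (rpow_ne_zero_of_mem_powDomain (hUp z hz) hu)).1] at hd
  simp only [eU, Matrix.cons_val_zero, Matrix.cons_val_one] at hd
  linear_combination -hd / 2

/-- The x-derivative of the m_x-relation leaves only -p u^p η_x. Unlike (p-1)η_x = 0, this also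
covers p = 1. -/
theorem uComp_x_eq_zero (hp : p ≠ 0) (hU : IsOpen U)
    (hUp : ∀ z ∈ U, z.2.2 0 ∈ powDomain p) (h : IsPointSymmetry (gchSystem p) U X)
    {z : TotalSpace 2} (hz : z ∈ U) (hu : u z ≠ 0) :
    pd eX (uComp X 0) z = 0 := by
  have hΞ := contDiffOn_xComp h.1
  have hV := isOpen_inter_u_ne_zero hU
  have hK : u z ^ p ≠ 0 := rpow_ne_zero_of_mem_powDomain (hUp z hz) hu
  have hd := evolution_mx_derivative hp hU hUp h hz hu eX
  have e : pd eX (pd eT (xComp X)) z = 0 := by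
    rw [pd_comm hΞ hU hz]
    exact pd_eq_zero_of_forall hV (fun y hy => xComp_x_eq_zero hp hU hUp h hy.1 hy.2) ⟨hz, hu⟩ _
  rw [e, xComp_xx_eq_zero hp hU hUp h hz hu, (tComp_mixed_eq_zero hU h hz).1] at hd
  simp only [eX, Pi.zero_apply] at hd
  have : u z ^ p * (p * pd eX (uComp X 0) z) = 0 := by
    simp only [eX]
    linear_combination -hd
  simpa [hK, hp] using this

/-- The formula for φ gives φ_m = η_u once ξ_x = 0, and then pη_u = -τ_t by `pd_u_uComp`. -/
theorem momentum_coefficient_m (hp : p ≠ 0) (hU : IsOpen U)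
    (hUp : ∀ z ∈ U, z.2.2 0 ∈ powDomain p) (h : IsPointSymmetry (gchSystem p) U X)
    {z : TotalSpace 2} (hz : z ∈ U) (hu : u z ≠ 0) :
    p * pd eM (uComp X 1) z = - pd eT (tComp X) z := by
  have hH := contDiffOn_uComp h.1 0
  have hV := isOpen_inter_u_ne_zero hU
  have hHm : ∀ y ∈ U, pd eM (uComp X 0) y = 0 := fun y hy => (momentum_linear hU h hy).2.2.2.1
  have e1 : pd eM (pd eX (pd eX (uComp X 0))) z = 0 := by
    rw [pd_comm (hH.pd hU eX) hU hz]
    refine pd_eq_zero_of_forall hU (fun y hy => ?_) hz eX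
    rw [pd_comm hH hU hy]
    exact pd_eq_zero_of_forall hU hHm hy eX
  have e2 : pd eM (pd eU (uComp X 0)) z = 0 := by
    rw [pd_comm hH hU hz]
    exact pd_eq_zero_of_forall hU hHm hz eU
  have hd := momentum_coefficient_derivative hU h hz eM
  rw [e1, e2, (xComp_mixed_eq_zero hU h hz eX).2, hHm z hz,
    xComp_x_eq_zero hp hU hUp h hz hu] at hd
  simp only [eM, Matrix.cons_val_zero, Matrix.cons_val_one] at hd
  have h1 := pd_u_uComp hp hU hUp h hz hu
  rw [xComp_x_eq_zero hp hU hUp h hz hu] at h1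
  simp only [eM]
  linear_combination p * hd - h1

/-- With η_x = φ_x = 0 the formula for φ_t gives φ_t = 0; the t-derivative of pφ_m = -τ_t then has
zero left side. -/
theorem tComp_tt_eq_zero (hp : p ≠ 0) (hU : IsOpen U)
    (hUp : ∀ z ∈ U, z.2.2 0 ∈ powDomain p) (h : IsPointSymmetry (gchSystem p) U X)
    {z : TotalSpace 2} (hz : z ∈ U) (hu : u z ≠ 0) :
    pd eT (pd eT (tComp X)) z = 0 := by
  have hT := contDiffOn_tComp h.1
  have hH := contDiffOn_uComp h.1 0
  have hP := contDiffOn_uComp h.1 1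
  have hV := isOpen_inter_u_ne_zero hU
  have hHx : ∀ y ∈ {y | y ∈ U ∧ u y ≠ 0}, pd eX (uComp X 0) y = 0 := fun y hy =>
    uComp_x_eq_zero hp hU hUp h hy.1 hy.2
  have hPx : ∀ y ∈ {y | y ∈ U ∧ u y ≠ 0}, pd eX (uComp X 1) y = 0 := by
    intro y hy
    have hd := momentum_coefficient_derivative hU h hy.1 eX
    have e1 : pd eX (pd eX (pd eX (uComp X 0))) y = 0 :=
      pd_eq_zero_of_forall hV (fun w hw => pd_eq_zero_of_forall hV hHx hw eX) hy eX
    rw [e1, hHx y hy, uComp_xu_eq_zero hp hU hUp h hy.1 hy.2,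
      xComp_xx_eq_zero hp hU hUp h hy.1 hy.2, xComp_x_eq_zero hp hU hUp h hy.1 hy.2] at hd
    simp only [eX, Pi.zero_apply] at hd ⊢
    linear_combination hd
  have hPt : ∀ y ∈ {y | y ∈ U ∧ u y ≠ 0}, pd eT (uComp X 1) y = 0 := by
    intro y hy
    rw [(evolution_linear hp hU h hy.1 hy.2
      (rpow_ne_zero_of_mem_powDomain (hUp y hy.1) hy.2)).2.2.1, hHx y hy, hPx y hy]
    ring
  have hd := (((HasLineDerivAt.const' p z eT).mul'
    ((hP.pd hU eM).hasLineDerivAt hU hz eT)).add'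
    ((hT.pd hU eT).hasLineDerivAt hU hz eT)).eq_zero_of_forall hV ⟨hz, hu⟩
    (fun y hy => by rw [momentum_coefficient_m hp hU hUp h hy.1 hy.2]; ring)
  rw [pd_comm hP hU hz, pd_eq_zero_of_forall hV hPt ⟨hz, hu⟩] at hd
  linear_combination hd

theorem coefficients_eq (hp : p ≠ 0) (hU : IsOpen U)
    (hUp : ∀ z ∈ U, z.2.2 0 ∈ powDomain p) (h : IsPointSymmetry (gchSystem p) U X)
    {z : TotalSpace 2} (hz : z ∈ U) (hu : u z ≠ 0) :
    p * uComp X 0 z + pd eT (tComp X) z * u z = 0 ∧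
      p * uComp X 1 z + pd eT (tComp X) z * m z = 0 ∧ pd eT (xComp X) z = 0 := by
  have hV := isOpen_inter_u_ne_zero hU
  have hK : u z ^ p ≠ 0 := rpow_ne_zero_of_mem_powDomain (hUp z hz) hu
  have hΞx := xComp_x_eq_zero hp hU hUp h hz hu
  have hHu := pd_u_uComp hp hU hUp h hz hu
  have hB := scaling_relation hp hU hUp h hz hu
  have hPm := momentum_coefficient_m hp hU hUp h hz hu
  have hHxx : pd eX (pd eX (uComp X 0)) z = 0 :=
    pd_eq_zero_of_forall hV (fun y hy => uComp_x_eq_zero hp hU hUp h hy.1 hy.2) ⟨hz, hu⟩ eX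
  have hP := (momentum_linear hU h hz).2.2.2.2.2.2.2
  obtain ⟨-, hΞt, -, -, h1⟩ := evolution_linear hp hU h hz hu hK
  rw [hΞx] at hHu hB hP h1 hΞt
  rw [hHxx] at hP
  have hTt : pd eT (tComp X) z = -p * pd eU (uComp X 0) z := by linear_combination -hHu
  have hPm' : pd eM (uComp X 1) z = pd eU (uComp X 0) z := by
    apply mul_left_cancel₀ hp
    linear_combination hPm - hTt
  rw [hTt] at hB h1 hΞt ⊢
  rw [hPm'] at h1
  have hB' : (p - 1) * (uComp X 0 z - u z * pd eU (uComp X 0) z) = 0 := by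
    linear_combination -hB
  -- `hB'` alone would leave p = 1 open. The u_x-coefficient `h1` equals a nonzero multiple of η -
  -- uη_u modulo multiples of `hB'`, so no case distinction is needed.
  have hS : uComp X 0 z = u z * pd eU (uComp X 0) z := by
    rw [hP] at h1
    have hinv : u z * (u z)⁻¹ = 1 := mul_inv_cancel₀ hu
    have : p * (u z)⁻¹ * (uComp X 0 z - u z * pd eU (uComp X 0) z) = 0 := by
      linear_combination -h1 / 2 - (p * (u z)⁻¹ ^ 2 * m z + p ^ 2 * (u z)⁻¹ / 4) * hB'
        - (p * (p - 1) * (u z)⁻¹ * m z + p ^ 2 * (p - 1) / 4) * pd eU (uComp X 0) z * hinv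
    exact sub_eq_zero.1 ((mul_eq_zero.1 this).resolve_left (mul_ne_zero hp (inv_ne_zero hu)))
  refine ⟨?_, ?_, ?_⟩
  · rw [hS]; ring
  · rw [hP, hS]; ring
  · rw [hS] at hΞt
    have : pd eT (xComp X) z * u z = 0 := by rw [← hΞt]; ring
    exact (mul_eq_zero.1 this).resolve_right hu

end Solving

/-! ### Extension across u = 0 -/

section Density

variable {U : Set (TotalSpace 2)}

theorem frequently_u_ne_zero (z : TotalSpace 2) : ∃ᶠ y in nhds z, u y ≠ 0 := by
  intro h
  have h0 : u z = 0 := not_not.1 h.self_of_nhds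
  have hc : Continuous fun s : ℝ => z + s • eU := by fun_prop
  have ht : Filter.Tendsto (fun s : ℝ => z + s • eU) (nhds 0) (nhds z) := by
    simpa using hc.tendsto 0
  have h1 : ∀ᶠ s : ℝ in nhdsWithin 0 {0}ᶜ, ¬u (z + s • eU) ≠ 0 :=
    (ht.eventually h).filter_mono nhdsWithin_le_nhds
  obtain ⟨s, hs, hs0⟩ := (h1.and self_mem_nhdsWithin).exists
  apply hs
  have : u (z + s • eU) = u z + s := by simp [u, eU]
  rw [this, h0, zero_add]
  exact hs0

/-- The locus u = 0 may cut U into several pieces. Extending the identities first, by continuity,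
lets one set of integration constants serve all of U. -/
theorem eq_zero_of_u_ne_zero (hU : IsOpen U) {f : TotalSpace 2 → ℝ} (hf : ContDiffOn ℝ ∞ f U)
    (h : ∀ z ∈ U, u z ≠ 0 → f z = 0) : ∀ z ∈ U, f z = 0 := by
  intro z hz
  by_contra hne
  have h1 : ∀ᶠ y in nhds z, f y ≠ 0 :=
    (hf.continuousOn.continuousAt (hU.mem_nhds hz)).eventually_ne hne
  obtain ⟨y, hy, hfy, hyU⟩ :=
    ((frequently_u_ne_zero z).and_eventually (h1.and (hU.mem_nhds hz))).exists
  exact hfy (h y hyU hy)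

end Density

/-! ### Translations and scaling, with their prolongation -/

section Generators

variable {q : ℕ}

/-- The combination `a ∂_x + b ∂_t + c (∑ u^α ∂_{u^α} - p t ∂_t)` of translations and scaling. -/
def scalingField (p a b c : ℝ) (z : TotalSpace q) : TotalSpace q :=
  (b - p * c * z.1, a, c • z.2.2)

theorem contDiff_scalingField (p a b c : ℝ) :
    ContDiff ℝ ∞ (scalingField p a b c : TotalSpace q → TotalSpace q) := by
  unfold scalingField
  fun_prop

theorem iterate_totalDerivX_scalingField (p a b c : ℝ) (α : Fin q) (j : ℕ) :
    totalDerivX^[j] (characteristic (scalingField p a b c) α) = fun J =>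
      c * J.coord α 0 j - (b - p * c * J.1) * J.coord α 1 j - a * J.coord α 0 (j + 1) := by
  induction j with
  | zero => rfl
  | succ j ih =>
    rw [Function.iterate_succ_apply', ih]
    funext J
    have hc (r : ℝ) := HasLineDerivAt.const' r J J.dirX
    rw [totalDerivX_apply, ((((hc c).mul' (hasLineDerivAt_coord α 0 j J J.dirX)).sub'
      (((hc b).sub' ((hc (p * c)).mul' (hasLineDerivAt_time J J.dirX))).mul'
        (hasLineDerivAt_coord α 1 j J J.dirX))).sub'
      ((hc a).mul' (hasLineDerivAt_coord α 0 (j + 1) J J.dirX))).lineDeriv]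
    simp only [coord_dirX, fst_dirX]
    ring

theorem prolong_scalingField_zero (p a b c : ℝ) (α : Fin q) (j : ℕ) (J : JetSpace q) :
    (prolong (scalingField p a b c) J).coord α 0 j = c * J.coord α 0 j := by
  have h : (prolong (scalingField p a b c) J).coord α 0 j =
      totalDerivX^[j] (characteristic (scalingField p a b c) α) J
        + (b - p * c * J.1) * J.coord α (0 + 1) j + a * J.coord α 0 (j + 1) := rfl
  rw [h, iterate_totalDerivX_scalingField]
  ring

/-- The extra weight pc comes from D_t acting on the coefficient b - pct of ∂_t. -/
theorem prolong_scalingField_one (p a b c : ℝ) (α : Fin q) (j : ℕ) (J : JetSpace q) :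
    (prolong (scalingField p a b c) J).coord α 1 j = c * (1 + p) * J.coord α 1 j := by
  have h : (prolong (scalingField p a b c) J).coord α 1 j =
      totalDerivT (totalDerivX^[j] (characteristic (scalingField p a b c) α)) J
        + (b - p * c * J.1) * J.coord α (1 + 1) j + a * J.coord α 1 (j + 1) := rfl
  have hc (r : ℝ) := HasLineDerivAt.const' r J J.dirT
  rw [h, iterate_totalDerivX_scalingField, totalDerivT_apply,
    ((((hc c).mul' (hasLineDerivAt_coord α 0 j J J.dirT)).sub'
      (((hc b).sub' ((hc (p * c)).mul' (hasLineDerivAt_time J J.dirT))).mul'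
        (hasLineDerivAt_coord α 1 j J J.dirT))).sub'
      ((hc a).mul' (hasLineDerivAt_coord α 0 (j + 1) J J.dirT))).lineDeriv]
  simp only [coord_dirT, fst_dirT]
  ring

theorem coord_add_smul (J v : JetSpace q) (s : ℝ) (α : Fin q) (i j : ℕ) :
    (J + s • v).coord α i j = J.coord α i j + s * v.coord α i j := rfl

end Generators

/-! ### Homogeneity of the right-hand sides -/

section Homogeneity

/-- A real power of a negative y is exp(e log|y|) cos(πe), so a positive factor still comes out.
Homogeneity thus needs no restriction on u. -/
theorem mul_rpow_of_pos {r : ℝ} (hr : 0 < r) (y e : ℝ) : (r * y) ^ e = r ^ e * y ^ e := by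
  rcases le_or_gt 0 y with hy | hy
  · exact Real.mul_rpow hr.le hy
  · rw [Real.rpow_def_of_neg (mul_neg_of_pos_of_neg hr hy), Real.rpow_def_of_neg hy,
      Real.log_mul hr.ne' hy.ne, add_mul, Real.exp_add, Real.rpow_def_of_pos hr, mul_assoc]

theorem rpow_shift {r : ℝ} (hr : 0 < r) (p : ℝ) :
    r ^ (p - 1) = r ^ (p - 2) * r ∧ r ^ p = r ^ (p - 2) * r ^ 2 ∧
      r ^ (p + 1) = r ^ (p - 2) * r ^ 3 := by
  refine ⟨?_, ?_, ?_⟩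
  · rw [← Real.rpow_add_one hr.ne']; ring_nf
  · rw [← Real.rpow_natCast r 2, ← Real.rpow_add hr]; norm_num
  · rw [← Real.rpow_natCast r 3, ← Real.rpow_add hr]; norm_num; ring_nf

theorem gchFlow_mul {r : ℝ} (hr : 0 < r) (p u ux m mx : ℝ) :
    gchFlow p (r * u) (r * ux) (r * m) (r * mx) = r ^ (p + 1) * gchFlow p u ux m mx := by
  obtain ⟨h1, h2, h3⟩ := rpow_shift hr p
  simp only [gchFlow, mul_rpow_of_pos hr]
  rw [h1, h2, h3]
  ring

/-- The right hand side of the scalar equation. -/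
noncomputable def gchScalarFlow (p u ux uxx uxxx : ℝ) : ℝ :=
  1 / 2 * (p + 1) * (p + 2) * u ^ p * ux - 1 / 2 * p * (p - 1) * u ^ (p - 2) * ux ^ 3
    - 2 * p * u ^ (p - 1) * ux * uxx - u ^ p * uxxx

theorem gchScalarFlow_mul {r : ℝ} (hr : 0 < r) (p u ux uxx uxxx : ℝ) :
    gchScalarFlow p (r * u) (r * ux) (r * uxx) (r * uxxx) =
      r ^ (p + 1) * gchScalarFlow p u ux uxx uxxx := by
  obtain ⟨h1, h2, h3⟩ := rpow_shift hr p
  simp only [gchScalarFlow, mul_rpow_of_pos hr]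
  rw [h1, h2, h3]
  ring

theorem hasDerivAt_weight (p c F : ℝ) :
    HasDerivAt (fun s : ℝ => (1 + s * (c * (1 + p))) * F - (1 + s * c) ^ (p + 1) * F) 0 0 := by
  have h1 (d : ℝ) : HasDerivAt (fun s : ℝ => 1 + s * d) d 0 := by
    simpa using ((hasDerivAt_id (0 : ℝ)).mul_const d).const_add 1
  have h2 := ((h1 (c * (1 + p))).mul_const F).sub
    (((h1 c).rpow_const (p := p + 1) (Or.inl (by simp))).mul_const F)
  refine h2.congr_deriv ?_
  simp
  ring

/-- F is the common value of the two sides of an equation at the jet; the left side has weight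
c(1+p), the right side is homogeneous of degree p + 1, and the first-order terms in s cancel. Powers
of u are never differentiated, so u = 0 is allowed. -/
theorem lineDeriv_eq_zero_of_weight {E : Type*} [AddCommGroup E] [Module ℝ E] {G : E → ℝ}
    {J v : E} (p c F : ℝ) (h : ∀ s : ℝ, 0 < 1 + s * c →
      G (J + s • v) = (1 + s * (c * (1 + p))) * F - (1 + s * c) ^ (p + 1) * F) :
    lineDeriv ℝ G J v = 0 := by
  have hc : Continuous fun s : ℝ => 1 + s * c := by fun_prop
  have hpos : ∀ᶠ s : ℝ in nhds 0, 0 < 1 + s * c :=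
    hc.continuousAt.eventually (lt_mem_nhds (by simp))
  have he : (fun s : ℝ => G (J + s • v)) =ᶠ[nhds 0]
      fun s => (1 + s * (c * (1 + p))) * F - (1 + s * c) ^ (p + 1) * F := by
    filter_upwards [hpos] with s hs using h s hs
  exact ((hasDerivAt_weight p c F).congr_of_eventuallyEq he).deriv

end Homogeneity

/-! ### Classification, Lie bracket and linear independence -/

section Symmetry

variable {p : ℝ}

theorem isPointSymmetry_gchSystem_of_eq {U : Set (TotalSpace 2)} (hU : IsOpen U)
    {X : TotalSpace 2 → TotalSpace 2} {a b c : ℝ} (hX : ∀ z ∈ U, X z = scalingField p a b c z) :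
    IsPointSymmetry (gchSystem p) U X := by
  refine ⟨(contDiff_scalingField p a b c).contDiffOn.congr hX, fun J hJ hs k => ?_⟩
  rw [prolong_congr_over hU hX hJ]
  fin_cases k
  · change lineDeriv ℝ (gchSystem p 0) J _ = 0
    have h0 := hs 0
    rw [gchSystem_zero_apply] at h0
    rw [(hasLineDerivAt_gchSystem_zero p J _).lineDeriv]
    simp only [prolong_scalingField_zero]
    linear_combination c * h0
  · change lineDeriv ℝ (gchSystem p 1) J _ = 0
    have h1 := hs 1
    rw [gchSystem_one_apply] at h1
    apply lineDeriv_eq_zero_of_weight p c (J.coord 1 1 0)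
    intro s hs'
    have e (x : ℝ) : x + s * (c * x) = (1 + s * c) * x := by ring
    rw [gchSystem_one_apply]
    simp only [coord_add_smul, prolong_scalingField_zero, prolong_scalingField_one, e,
      gchFlow_mul hs']
    rw [← sub_eq_zero.1 h1]
    ring

theorem isPointSymmetry_gchScalar_scalingField (V : Set (TotalSpace 1)) (a b c : ℝ) :
    IsPointSymmetry (gchScalar p) V (scalingField p a b c) := by
  refine ⟨(contDiff_scalingField p a b c).contDiffOn, fun J _ hs k => ?_⟩
  have hG (K : JetSpace 1) : gchScalar p 0 K = (K.coord 0 1 0 - K.coord 0 1 2)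
      - gchScalarFlow p (K.coord 0 0 0) (K.coord 0 0 1) (K.coord 0 0 2) (K.coord 0 0 3) := rfl
  obtain rfl : k = 0 := Subsingleton.elim _ _
  have h1 := hs 0
  rw [hG] at h1
  apply lineDeriv_eq_zero_of_weight p c (J.coord 0 1 0 - J.coord 0 1 2)
  intro s hs'
  have e (x : ℝ) : x + s * (c * x) = (1 + s * c) * x := by ring
  rw [hG]
  simp only [coord_add_smul, prolong_scalingField_zero, prolong_scalingField_one, e,
    gchScalarFlow_mul hs']
  rw [← sub_eq_zero.1 h1]
  ring

theorem exists_eq_scalingField (hp : p ≠ 0) {U : Set (TotalSpace 2)} (hU : IsOpen U)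
    (hUc : IsConnected U) (hUp : ∀ z ∈ U, z.2.2 0 ∈ powDomain p)
    {X : TotalSpace 2 → TotalSpace 2} (h : IsPointSymmetry (gchSystem p) U X) :
    ∃ a b c : ℝ, ∀ z ∈ U, X z = scalingField p a b c z := by
  have hT := contDiffOn_tComp h.1
  have hΞ := contDiffOn_xComp h.1
  have hH := contDiffOn_uComp h.1 0
  have hP := contDiffOn_uComp h.1 1
  have hu : ContDiffOn ℝ ∞ u U := contDiff_u.contDiffOn
  have hm : ContDiffOn ℝ ∞ m U := contDiff_m.contDiffOn
  have hTt := hT.pd hU eT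
  have hTtt := eq_zero_of_u_ne_zero hU (hTt.pd hU eT)
    (fun z hz hz0 => tComp_tt_eq_zero hp hU hUp h hz hz0)
  have hΞx := eq_zero_of_u_ne_zero hU (hΞ.pd hU eX)
    (fun z hz hz0 => xComp_x_eq_zero hp hU hUp h hz hz0)
  have hΞt := eq_zero_of_u_ne_zero hU (hΞ.pd hU eT)
    (fun z hz hz0 => (coefficients_eq hp hU hUp h hz hz0).2.2)
  have hHeq := eq_zero_of_u_ne_zero hU ((contDiffOn_const.mul hH).add (hTt.mul hu))
    (fun z hz hz0 => (coefficients_eq hp hU hUp h hz hz0).1)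
  have hPeq := eq_zero_of_u_ne_zero hU ((contDiffOn_const.mul hP).add (hTt.mul hm))
    (fun z hz hz0 => (coefficients_eq hp hU hUp h hz hz0).2.1)
  obtain ⟨a, ha⟩ := hU.exists_is_const_of_fderiv_eq_zero hUc.isPreconnected
    (fun z hz => (hΞ.differentiableAt_of_isOpen hU hz).differentiableWithinAt)
    (fun z hz => fderiv_eq_zero_iff.2 ⟨hΞt z hz, hΞx z hz, (momentum_consequences hU h hz).1,
      (momentum_linear hU h hz).2.2.2.2.1⟩)
  obtain ⟨k, hk⟩ := hU.exists_is_const_of_fderiv_eq_zero hUc.isPreconnected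
    (fun z hz => (hTt.differentiableAt_of_isOpen hU hz).differentiableWithinAt)
    (fun z hz => fderiv_eq_zero_iff.2 ⟨hTtt z hz, tComp_mixed_eq_zero hU h hz⟩)
  have ht : ContDiff ℝ ∞ fun z : TotalSpace 2 => k * z.1 := by fun_prop
  have htd (z v : TotalSpace 2) : pd v (fun z : TotalSpace 2 => k * z.1) z = k * v.1 := by
    have h1 : HasFDerivAt (fun z : TotalSpace 2 => k * z.1)
        (k • ContinuousLinearMap.fst ℝ ℝ (ℝ × (Fin 2 → ℝ))) z :=
      hasFDerivAt_fst.const_mul k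
    rw [pd, h1.fderiv]
    rfl
  obtain ⟨b, hb⟩ := hU.exists_eq_add_of_fderiv_eq (f := tComp X) (g := fun z => k * z.1)
    hUc.isPreconnected
    (fun z hz => (hT.differentiableAt_of_isOpen hU hz).differentiableWithinAt)
    (ht.differentiable (by simp)).differentiableOn
    (fun z hz => by
      obtain ⟨hTx, hTu, hTm, -⟩ := momentum_linear hU h hz
      have hTz : pd eT (tComp X) z = k := hk z hz
      refine ContinuousLinearMap.ext fun w => ?_
      have hw := htd z w
      simp only [pd] at hTz hTx hTu hTm hw
      rw [clm_apply (fderiv ℝ (tComp X) z) w, hTz, hTx, hTu, hTm, hw]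
      simp only [smul_eq_mul]
      ring)
  -- Here k is the constant τ_t, and the scaling has τ_t = -p.
  refine ⟨a, b, -k / p, fun z hz => ?_⟩
  have hH' := hHeq z hz
  have hP' := hPeq z hz
  have hb' := hb hz
  simp only [hk z hz] at hH' hP'
  refine Prod.ext ?_ (Prod.ext (ha z hz) (funext fun i => ?_))
  · change tComp X z = b - p * (-k / p) * z.1
    rw [hb']
    field_simp
    ring
  · fin_cases i
    · change uComp X 0 z = -k / p * u z
      field_simp
      linear_combination hH'
    · change uComp X 1 z = -k / p * m z
      field_simp
      linear_combination hP'

/-- Translations commute and the scaling commutes with ∂_x, so only the bracket of the scaling with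
∂_t survives, and it is a multiple of ∂_t. -/
theorem lieBracket_scalingField {q : ℕ} {U : Set (TotalSpace q)} (hU : IsOpen U)
    {X Y : TotalSpace q → TotalSpace q} {a b c a' b' c' : ℝ}
    (hX : ∀ z ∈ U, X z = scalingField p a b c z) (hY : ∀ z ∈ U, Y z = scalingField p a' b' c' z) :
    ∀ z ∈ U, VectorField.lieBracket ℝ X Y z = scalingField p 0 (p * (c * b' - c' * b)) 0 z := by
  intro z hz
  have hd (Z : TotalSpace q → TotalSpace q) (a b c : ℝ)
      (hZ : ∀ z ∈ U, Z z = scalingField p a b c z) (v : TotalSpace q) :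
      fderiv ℝ Z z v = (-(p * c) * v.1, 0, c • v.2.2) := by
    have he : Z =ᶠ[nhds z] scalingField p a b c := by
      filter_upwards [hU.mem_nhds hz] with y hy using hZ y hy
    have h1 : HasFDerivAt (scalingField p a b c : TotalSpace q → TotalSpace q)
        ((-((p * c) • ContinuousLinearMap.fst ℝ ℝ (ℝ × (Fin q → ℝ)))).prod
          ((0 : TotalSpace q →L[ℝ] ℝ).prod (c • (ContinuousLinearMap.snd ℝ ℝ (Fin q → ℝ)).comp
            (ContinuousLinearMap.snd ℝ ℝ (ℝ × (Fin q → ℝ)))))) z :=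
      ((hasFDerivAt_fst.const_mul (p * c)).const_sub b).prodMk
        ((hasFDerivAt_const a z).prodMk
          (((ContinuousLinearMap.snd ℝ ℝ (Fin q → ℝ)).comp
            (ContinuousLinearMap.snd ℝ ℝ (ℝ × (Fin q → ℝ)))).hasFDerivAt.const_smul c))
    rw [he.fderiv_eq, h1.fderiv]
    refine Prod.ext ?_ (Prod.ext rfl rfl)
    change -(p * c * v.1) = -(p * c) * v.1
    ring
  rw [VectorField.lieBracket, hd Y a' b' c' hY, hd X a b c hX, hX z hz, hY z hz]
  refine Prod.ext ?_ (Prod.ext ?_ (funext fun i => ?_))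
  · simp only [scalingField, Prod.fst_sub]
    ring
  · simp [scalingField]
  · simp only [scalingField, Prod.snd_sub, Pi.sub_apply, Pi.smul_apply, smul_eq_mul]
    ring

theorem sum_smul_gchGenerator (p : ℝ) (g : Fin 3 → ℝ) (z : TotalSpace 2) :
    ∑ i, g i • gchGenerator p i z = scalingField p (g 0) (g 1) (g 2) z := by
  rw [Fin.sum_univ_three]
  refine Prod.ext ?_ (Prod.ext ?_ (funext fun i => ?_))
  · simp [gchGenerator, scalingField]
    ring
  · simp [gchGenerator, scalingField]
  · fin_cases i <;> simp [gchGenerator, scalingField]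

theorem sum_smul_domRestrict_apply (p : ℝ) (U : Set (TotalSpace 2)) (g : Fin 3 → ℝ) (z : U) :
    (∑ i, g i • U.domRestrict (gchGenerator p i)) z = scalingField p (g 0) (g 1) (g 2) z := by
  rw [← sum_smul_gchGenerator, Finset.sum_apply]
  rfl

theorem linearIndependent_gchGenerator {U : Set (TotalSpace 2)} (hU : IsOpen U)
    (hne : U.Nonempty) :
    LinearIndependent ℝ (fun i => U.domRestrict (gchGenerator p i)) := by
  rw [Fintype.linearIndependent_iff]
  intro g hg
  have hz (z : TotalSpace 2) (hz : z ∈ U) : scalingField p (g 0) (g 1) (g 2) z = 0 := by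
    rw [← sum_smul_domRestrict_apply p U g ⟨z, hz⟩, hg]
    rfl
  obtain ⟨z, hzU⟩ := hne
  -- The u-component of the combination is g 2 times u, which determines g 2 only where u ≠ 0.
  obtain ⟨y, hy0, hyU⟩ := ((frequently_u_ne_zero z).and_eventually (hU.mem_nhds hzU)).exists
  have hy := hz y hyU
  have h0 : g 0 = 0 := congrArg (fun w : TotalSpace 2 => w.2.1) hy
  have h2 : g 2 = 0 :=
    (mul_eq_zero.1 (congrArg u hy : g 2 * u y = 0)).resolve_right hy0
  have h1 : g 1 = 0 := by
    have : g 1 - p * g 2 * y.1 = 0 := congrArg Prod.fst hy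
    simpa [h2] using this
  intro i
  fin_cases i
  · exact h0
  · exact h1
  · exact h2

theorem domRestrict_mem_span_iff {U : Set (TotalSpace 2)} {X : TotalSpace 2 → TotalSpace 2} :
    U.domRestrict X ∈ Submodule.span ℝ (Set.range fun i => U.domRestrict (gchGenerator p i)) ↔
      ∃ a b c : ℝ, ∀ z ∈ U, X z = scalingField p a b c z := by
  rw [Submodule.mem_span_range_iff_exists_fun]
  constructor
  · rintro ⟨g, hg⟩
    refine ⟨g 0, g 1, g 2, fun z hz => ?_⟩
    rw [← sum_smul_domRestrict_apply p U g ⟨z, hz⟩, hg]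
    rfl
  · rintro ⟨a, b, c, h⟩
    refine ⟨![a, b, c], funext fun z => ?_⟩
    rw [sum_smul_domRestrict_apply]
    exact (h z z.2).symm

end Symmetry

theorem proposition1 (p : ℝ) (hp : p ≠ 0) (U : Set (TotalSpace 2))
    (hU : IsOpen U) (hUc : IsConnected U) (hUp : ∀ z ∈ U, z.2.2 0 ∈ powDomain p) :
    -- the three generators are linearly independent over `ℝ`
    LinearIndependent ℝ (fun i => U.domRestrict (gchGenerator p i)) ∧
    -- the point symmetries of the system are exactly the vector fields they span
    (∀ X : TotalSpace 2 → TotalSpace 2, IsPointSymmetry (gchSystem p) U X ↔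
      U.domRestrict X ∈ Submodule.span ℝ (Set.range fun i => U.domRestrict (gchGenerator p i))) ∧
    -- they form a Lie algebra of vector fields
    (∀ X Y : TotalSpace 2 → TotalSpace 2,
      IsPointSymmetry (gchSystem p) U X → IsPointSymmetry (gchSystem p) U Y →
      IsPointSymmetry (gchSystem p) U (VectorField.lieBracket ℝ X Y)) ∧
    -- they project to point symmetries of the scalar equation
    (∀ X : TotalSpace 2 → TotalSpace 2, IsPointSymmetry (gchSystem p) U X →
      ∃ Y : TotalSpace 1 → TotalSpace 1,
        (∀ z ∈ U, Y (forgetM z) = forgetM (X z)) ∧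
        IsPointSymmetry (gchScalar p) (forgetM '' U) Y) := by
  refine ⟨linearIndependent_gchGenerator hU hUc.nonempty, fun X => ?_, fun X Y hX hY => ?_,
    fun X hX => ?_⟩
  · rw [domRestrict_mem_span_iff]
    refine ⟨fun h => exists_eq_scalingField hp hU hUc hUp h, ?_⟩
    rintro ⟨a, b, c, h⟩
    exact isPointSymmetry_gchSystem_of_eq hU h
  · obtain ⟨a, b, c, h⟩ := exists_eq_scalingField hp hU hUc hUp hX
    obtain ⟨a', b', c', h'⟩ := exists_eq_scalingField hp hU hUc hUp hY
    exact isPointSymmetry_gchSystem_of_eq hU (lieBracket_scalingField hU h h')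
  · obtain ⟨a, b, c, h⟩ := exists_eq_scalingField hp hU hUc hUp hX
    refine ⟨scalingField p a b c, fun z hz => ?_, isPointSymmetry_gchScalar_scalingField _ a b c⟩
    rw [h z hz]
    refine Prod.ext rfl (Prod.ext rfl (funext fun i => ?_))
    obtain rfl : i = 0 := Subsingleton.elim _ _
    rfl
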